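/- Let $\mathcal C[0,1]$ be the space of continuous maps $f:[0,1]\to[0,1]$ with the uniform topology, and give the set of Borel probability measures on $[0,1]$ the weak$^*$ topology, in which all closures are taken. Fix a sequence $\{\Psi_i\}_{i\ge1}$ dense in $\mathcal C[0,1]$ and put $\mathrm{dist}(\mu,\nu)=\sum_{i\ge1}2^{-i}\left|\int\Psi_i\,d\mu-\int\Psi_i\,d\nu\right|$. For $f\in\mathcal C[0,1]$ use the following notions. - For $x\in[0,1]$, $p\omega(x)$ is the set of weak$^*$ limits of convergent subsequences of $\frac1n\sum_{j=0}^{n-1}\delta_{f^j(x)}$, $n\ge1$. A probability measure $\mu$ is pseudo-physical if for every $\varepsilon>0$ the set $\{x\in[0,1]:\mathrm{dist}(p\omega(x),\mu)<\varepsilon\}$ has positive Lebesgue measure; $\mathcal O_f$ is the set of pseudo-physical measures. - $\mathcal M_f$ is the set of $f$-invariant Borel probability measures and $\mathcal E_f\subset\mathcal M_f$ the set of ergodic ones. $\mathrm{Per}_f$ is the set of periodic measures $\frac1r\sum_{j=0}^{r-1}\delta_{f^j(x_0)}$, where $x_0$ is a periodic point of period $r\ge1$. - A nonempty open interval $I\subset[0,1]$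 is periodic shrinking of period $p\ge1$ if the sets $f^j(\overline I)$, $0\le j\le p-1$, are pairwise disjoint, $f^p(\overline I)\subset I$, and $\mathrm{length}(f^j(I))<\mathrm{length}(I)$ for $1\le j\le p-1$. For $q\ge1$ call a measure $\mu$ $q$-shrinked if there is a periodic shrinking interval $I$, of some period $p$, with $\mathrm{length}(I)<1/q$ and $\mu\big(\bigcup_{j=1}^{p}f^j(\overline I)\big)=1$. - $\mathrm{Shr}_f$ is the set of $\mu\in\mathcal M_f$ that are $q$-shrinked for every $q\ge1$. $\mathrm{Shr}_q\mathrm{Per}_f$ is the set of $q$-shrinked measures in $\mathrm{Per}_f$. $\mathrm{AShr}_{\varepsilon,q}\mathrm{Per}_f$ is the set of $\mu\in\mathcal M_f$ such that $\mathrm{dist}(\mu,\nu)<\varepsilon$ for some $\nu\in\mathrm{Shr}_q\mathrm{Per}_f$. **Theorem.** There is a dense $G_\delta$ set $G\subset\mathcal C[0,1]$ such that every $f\in G$ satisfies $$\mathrm{Per}_f\subset\bigcap_{q\ge1}\overline{\mathrm{AShr}_{\varepsilon,q}\mathrm{Per}_f}\qquad\text{for all }\varepsilon>0,$$ and $$\bigcap_{\varepsilon>0}\bigcap_{q\ge1}\overline{\mathrm{AShr}_{\varepsilon,q}\mathrm{Per}_f}=\mathcal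 O_f=\overline{\mathrm{Shr}_f}=\overline{\mathcal E_f}=\overline{\mathrm{Per}_f}.$$ In particular, every ergodic $f$-invariant probability measure is pseudo-physical for $f$. -/

import Mathlib

open Set Filter Topology MeasureTheory unitInterval

noncomputable section

namespace IntervalDynamics

/-- The probability measure `(1/n) ∑_{j<n} δ_{f^j x}`, for `n ≥ 1`. -/
def orbitMeasure (f : C(I, I)) (x : I) (n : ℕ+) : ProbabilityMeasure I :=
  ⟨((n : ℕ) : ENNReal)⁻¹ • ∑ j ∈ Finset.range n, Measure.dirac (f^[j] x), ⟨by
    simp only [Measure.smul_apply, Measure.finsetSum_apply, measure_univ, Finset.sum_const,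
      Finset.card_range, smul_eq_mul, nsmul_eq_mul, mul_one]
    exact ENNReal.inv_mul_cancel (by exact_mod_cast n.ne_zero) (ENNReal.natCast_ne_top _)⟩⟩

/-- The distance `∑_{i ≥ 1} 2^{-i} |∫ Ψ_i dμ - ∫ Ψ_i dν|` between probability measures; the
sequence `Ψ` is enumerated from `0` here. -/
def measureDist (Ψ : ℕ → C(I, I)) (μ ν : ProbabilityMeasure I) : ℝ :=
  ∑' i : ℕ, (1 / 2 ^ (i + 1) : ℝ) *
    |∫ x, (Ψ i x : ℝ) ∂(μ : Measure I) - ∫ x, (Ψ i x : ℝ) ∂(ν : Measure I)|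

/-- `pω(x)`: the weak* limits of the convergent subsequences of the empirical measures of `x`. -/
def pomega (f : C(I, I)) (x : I) : Set (ProbabilityMeasure I) :=
  {μ | ∃ φ : ℕ → ℕ+, StrictMono φ ∧ Tendsto (fun k => orbitMeasure f x (φ k)) atTop (𝓝 μ)}

/-- `A_ε(μ)`: the points `x` with `dist (pω(x), μ) < ε`, the distance from a point to a set being
the infimum of the distances to its elements. -/
def basin (Ψ : ℕ → C(I, I)) (f : C(I, I)) (ε : ℝ) (μ : ProbabilityMeasure I) : Set I :=
  {x | ∃ ν ∈ pomega f x, measureDist Ψ ν μ < ε}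

/-- `O_f`: the pseudo-physical measures of `f`. -/
def pseudoPhysical (Ψ : ℕ → C(I, I)) (f : C(I, I)) : Set (ProbabilityMeasure I) :=
  {μ | ∀ ε : ℝ, 0 < ε → 0 < (volume : Measure I) (basin Ψ f ε μ)}

/-- `M_f`: the `f`-invariant Borel probability measures. -/
def invariantMeasures (f : C(I, I)) : Set (ProbabilityMeasure I) :=
  {μ | MeasurePreserving f (μ : Measure I) (μ : Measure I)}

/-- `E_f`: the ergodic invariant Borel probability measures. -/
def ergodicMeasures (f : C(I, I)) : Set (ProbabilityMeasure I) :=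
  {μ | Ergodic f (μ : Measure I)}

/-- `Per_f`: the invariant measures equidistributed on a periodic orbit. -/
def periodicMeasures (f : C(I, I)) : Set (ProbabilityMeasure I) :=
  {μ | ∃ (x : I) (r : ℕ+), Function.minimalPeriod f x = r ∧ μ = orbitMeasure f x r}

/-- The open interval `(a, b)`, whose closure is `[a, b]`, is periodic shrinking of period `p`.
The length of the interval `f^j((a, b))` is its diameter. -/
structure IsPeriodicShrinking (f : C(I, I)) (a b : I) (p : ℕ) : Prop where
  lt : a < b
  one_le : 1 ≤ p
  disjoint : ∀ i < p, ∀ j < p, i ≠ j → Disjoint (f^[i] '' Icc a b) (f^[j] '' Icc a b)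
  image_subset : f^[p] '' Icc a b ⊆ Ioo a b
  length_lt : ∀ j, 1 ≤ j → j ≤ p - 1 → Metric.diam (f^[j] '' Ioo a b) < (b : ℝ) - a

/-- The compact set `⋃_{j=1}^p f^j([a, b])`. -/
def orbitSet (f : C(I, I)) (a b : I) (p : ℕ) : Set I :=
  ⋃ j ∈ Finset.Icc 1 p, f^[j] '' Icc a b

/-- `μ` is carried by the orbit of a periodic shrinking interval of length less than `1/q`. -/
def IsShrinkedAt (f : C(I, I)) (q : ℕ) (μ : ProbabilityMeasure I) : Prop :=
  ∃ (a b : I) (p : ℕ), IsPeriodicShrinking f a b p ∧ (b : ℝ) - a < 1 / q ∧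
    (μ : Measure I) (orbitSet f a b p) = 1

/-- `Shr_f`: the infinitely shrinked invariant measures. -/
def shrinkedMeasures (f : C(I, I)) : Set (ProbabilityMeasure I) :=
  {μ | μ ∈ invariantMeasures f ∧ ∀ q : ℕ, 1 ≤ q → IsShrinkedAt f q μ}

/-- `Shr_q Per_f`: the `q`-shrinked periodic measures. -/
def shrinkedPeriodic (f : C(I, I)) (q : ℕ) : Set (ProbabilityMeasure I) :=
  {ν | ν ∈ periodicMeasures f ∧ IsShrinkedAt f q ν}

/-- `AShr_{ε,q} Per_f`: the invariant measures `ε`-approached by `q`-shrinked periodic measures. -/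
def approxShrinkedPeriodic (Ψ : ℕ → C(I, I)) (f : C(I, I)) (ε : ℝ) (q : ℕ) :
    Set (ProbabilityMeasure I) :=
  {μ | μ ∈ invariantMeasures f ∧ ∃ ν ∈ shrinkedPeriodic f q, measureDist Ψ μ ν < ε}

end IntervalDynamics

end

open IntervalDynamics

/-! Two features of a typical map, collected in `IsTypical`, imply everything. (1) If orbit segments
that nearly close up start near `c` and have empirical measures near `μ` (`IsClosable`), then
arbitrarily short periodic shrinking intervals exist near `c`, and all their points have one-period
orbit measures near `μ`. (2) Lebesgue-almost every orbit enters periodic shrinking intervals of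
every small length.

Both come from Baire's theorem. Periodic shrinking intervals survive small perturbations
(`IsPeriodicShrinking.eventually`), and a map can be made constant around finitely many points, with
values among these points, at small uniform cost (`exists_perturbation`). Applied along a nearly
closed segment this produces a cycle with locally constant dynamics (`mem_closure_shrinkingIn`);
applied to a fine grid it sends most of the interval into such cycles (`dense_stablyCapturing`).

Two facts hold for every map. Invariant measures carried by the orbit of one short shrinking
interval are close to each other, because each image has diameter at most that of the interval and
the measures are compared through averages over a period. Ergodic measures are closable: the mean
ergodic theorem gives both convergence of averages in measure and returns of positive measure at the
same times.

For a typical map, every ergodic measure is therefore a limit of shrinked periodic measures. It is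
pseudo-physical, since a shrinking interval has positive length and traps its points; and it is a
limit of infinitely shrinked measures, obtained by nesting shorter intervals and using compactness.
Conversely (2) makes the limit measures of almost every point infinitely shrinked, so
pseudo-physical measures are limits of these, and these in turn are limits of periodic measures. All
the closures coincide. -/

namespace IntervalDynamics

/-! ### Averages of Dirac masses -/

/-- The probability measure `(1/n) ∑_{j<n} δ_{z j}`. -/
noncomputable def avgDirac (n : ℕ+) (z : ℕ → I) : ProbabilityMeasure I :=
  ⟨((n : ℕ) : ENNReal)⁻¹ • ∑ j ∈ Finset.range n, Measure.dirac (z j), ⟨by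
    simp only [Measure.smul_apply, Measure.finsetSum_apply, measure_univ, Finset.sum_const,
      Finset.card_range, smul_eq_mul, nsmul_eq_mul, mul_one]
    exact ENNReal.inv_mul_cancel (by exact_mod_cast n.ne_zero) (ENNReal.natCast_ne_top _)⟩⟩

theorem orbitMeasure_eq_avgDirac (f : C(I, I)) (x : I) (n : ℕ+) :
    orbitMeasure f x n = avgDirac n (fun j => f^[j] x) := rfl

theorem avgDirac_congr {n : ℕ+} {z w : ℕ → I} (h : ∀ j < (n : ℕ), z j = w j) :
    avgDirac n z = avgDirac n w := by
  apply Subtype.ext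
  change ((n : ℕ) : ENNReal)⁻¹ • ∑ j ∈ Finset.range n, Measure.dirac (z j) =
    ((n : ℕ) : ENNReal)⁻¹ • ∑ j ∈ Finset.range n, Measure.dirac (w j)
  congr 1
  exact Finset.sum_congr rfl fun j hj => by rw [h j (Finset.mem_range.1 hj)]

theorem avgDirac_apply (n : ℕ+) (z : ℕ → I) (s : Set I) :
    (avgDirac n z : Measure I) s =
      ((n : ℕ) : ENNReal)⁻¹ * ∑ j ∈ Finset.range n, Measure.dirac (z j) s := by
  change (((n : ℕ) : ENNReal)⁻¹ • ∑ j ∈ Finset.range n, Measure.dirac (z j)) s = _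
  simp [Measure.finsetSum_apply]

theorem integral_avgDirac (n : ℕ+) (z : ℕ → I) (φ : I → ℝ) :
    ∫ x, φ x ∂(avgDirac n z : Measure I) = (n : ℝ)⁻¹ * ∑ j ∈ Finset.range n, φ (z j) := by
  change ∫ x, φ x ∂(((n : ℕ) : ENNReal)⁻¹ • ∑ j ∈ Finset.range n, Measure.dirac (z j)) = _
  rw [integral_smul_measure, integral_finsetSum_measure]
  · simp
  · intro j _
    exact integrable_dirac (by simp)

theorem integral_orbitMeasure (f : C(I, I)) (x : I) (n : ℕ+) (φ : I → ℝ) :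
    ∫ y, φ y ∂(orbitMeasure f x n : Measure I) =
      (n : ℝ)⁻¹ * ∑ j ∈ Finset.range n, φ (f^[j] x) :=
  integral_avgDirac n _ φ

theorem continuous_avgDirac (n : ℕ+) : Continuous (avgDirac n) := by
  rw [ProbabilityMeasure.continuous_iff_forall_continuous_integral]
  intro φ
  simp only [integral_avgDirac]
  fun_prop

theorem continuous_iterate_apply (j : ℕ) : Continuous fun q : C(I, I) × I => q.1^[j] q.2 := by
  induction j with
  | zero => exact continuous_snd
  | succ j ih =>
    simp only [Function.iterate_succ_apply']
    exact continuous_eval.comp (continuous_fst.prodMk ih)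

theorem continuous_orbitMeasure (n : ℕ+) :
    Continuous fun q : C(I, I) × I => orbitMeasure q.1 q.2 n :=
  (continuous_avgDirac n).comp (continuous_pi fun j => continuous_iterate_apply j)

theorem avgDirac_apply_eq_one {n : ℕ+} {z : ℕ → I} {s : Set I} (hs : MeasurableSet s)
    (h : ∀ j < (n : ℕ), z j ∈ s) : (avgDirac n z : Measure I) s = 1 := by
  rw [avgDirac_apply, Finset.sum_congr rfl
    (fun j hj => by rw [Measure.dirac_apply' _ hs, indicator_of_mem (h j (Finset.mem_range.1 hj))])]
  simpa using ENNReal.inv_mul_cancel (by exact_mod_cast n.ne_zero) (ENNReal.natCast_ne_top _)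

/-! ### Invariant measures -/

theorem isClosed_invariantMeasures (f : C(I, I)) : IsClosed (invariantMeasures f) := by
  have : invariantMeasures f =
      {μ | μ.map f.continuous.measurable.aemeasurable = μ} := by
    ext μ
    constructor
    · intro h
      exact Subtype.ext h.map_eq
    · intro h
      exact ⟨f.continuous.measurable, congrArg Subtype.val h⟩
  rw [this]
  exact isClosed_eq (ProbabilityMeasure.continuous_map f.continuous) continuous_id

theorem mem_invariantMeasures_of_integral {f : C(I, I)} {μ : ProbabilityMeasure I}
    (h : ∀ φ : BoundedContinuousFunction I ℝ,
      ∫ x, φ (f x) ∂(μ : Measure I) = ∫ x, φ x ∂(μ : Measure I)) : μ ∈ invariantMeasures f := by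
  refine ⟨f.continuous.measurable, ?_⟩
  refine ext_of_forall_integral_eq_of_IsFiniteMeasure fun φ => ?_
  rw [integral_map f.continuous.measurable.aemeasurable φ.continuous.aestronglyMeasurable, h φ]

theorem orbitMeasure_mem_invariantMeasures {f : C(I, I)} {x : I} {n : ℕ+}
    (h : f^[n] x = x) : orbitMeasure f x n ∈ invariantMeasures f := by
  apply mem_invariantMeasures_of_integral
  intro φ
  rw [integral_orbitMeasure f x n (fun y => φ (f y)), integral_orbitMeasure]
  congr 1
  have h1 := Finset.sum_range_succ (fun j => φ (f^[j] x)) n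
  have h2 := Finset.sum_range_succ' (fun j => φ (f^[j] x)) n
  simp only [Function.iterate_zero, id, h] at h1 h2
  simp only [← Function.iterate_succ_apply' (⇑f)]
  linarith

theorem isClosed_setOf_apply_eq_one {K : Set I} (hK : IsClosed K) :
    IsClosed {μ : ProbabilityMeasure I | (μ : Measure I) K = 1} := by
  rw [← isSeqClosed_iff_isClosed]
  intro μs μ hμs hμ
  have h := ProbabilityMeasure.limsup_measure_closed_le_of_tendsto hμ hK
  replace hμs : ∀ n, (μs n : Measure I) K = 1 := hμs
  simp only [hμs, limsup_const] at h
  exact le_antisymm prob_le_one h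

/-! ### Limits of empirical measures -/

theorem pomega_nonempty (f : C(I, I)) (x : I) : (pomega f x).Nonempty := by
  obtain ⟨μ, φ, hφ, hμ⟩ := CompactSpace.tendsto_subseq fun n : ℕ => orbitMeasure f x n.succPNat
  exact ⟨μ, fun k => (φ k).succPNat, fun i j hij => Nat.succPNat_lt_succPNat.2 (hφ hij), hμ⟩

theorem tendsto_coe_of_strictMono {φ : ℕ → ℕ+} (hφ : StrictMono φ) :
    Tendsto (fun k => (φ k : ℕ)) atTop atTop :=
  StrictMono.tendsto_atTop fun _ _ hij => PNat.coe_lt_coe _ _ |>.2 (hφ hij)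

theorem pomega_subset_invariantMeasures (f : C(I, I)) (x : I) :
    pomega f x ⊆ invariantMeasures f := by
  rintro μ ⟨φ, hφ, hμ⟩
  apply mem_invariantMeasures_of_integral
  intro ψ
  rw [ProbabilityMeasure.tendsto_iff_forall_integral_tendsto] at hμ
  have h1 := hμ ψ
  have h2 := hμ (ψ.compContinuous f)
  simp only [BoundedContinuousFunction.compContinuous_apply] at h2
  refine tendsto_nhds_unique h2 ?_
  -- The averages of `ψ` and `ψ ∘ f` over `n` steps differ by the telescoped term `(ψ x - ψ (f^[n]
  -- x)) / n`, which tends to `0`.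
  rw [← sub_zero (∫ x, ψ x ∂(μ : Measure I))]
  have h3 : Tendsto (fun k => ((φ k : ℕ) : ℝ)⁻¹ * (ψ x - ψ (f^[φ k] x))) atTop (𝓝 0) := by
    have h4 : Tendsto (fun k => ((φ k : ℕ) : ℝ)⁻¹) atTop (𝓝 0) :=
      tendsto_inv_atTop_zero.comp (tendsto_natCast_atTop_atTop.comp (tendsto_coe_of_strictMono hφ))
    refine h4.zero_mul_isBoundedUnder_le ?_
    refine isBoundedUnder_of ⟨2 * ‖ψ‖, fun k => ?_⟩
    have := ψ.dist_le_two_norm x (f^[φ k] x)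
    simpa [dist_eq_norm] using this
  refine (h1.sub h3).congr fun k => ?_
  rw [integral_orbitMeasure, integral_orbitMeasure f x (φ k) (fun y => ψ (f y)), ← mul_sub]
  congr 1
  have h1 := Finset.sum_range_succ (fun j => ψ (f^[j] x)) (φ k)
  have h2 := Finset.sum_range_succ' (fun j => ψ (f^[j] x)) (φ k)
  simp only [Function.iterate_zero, id] at h1 h2
  simp only [← Function.iterate_succ_apply' (⇑f)]
  linarith

/-- Only the first `m` iterates can lie outside `K`, so the empirical measures give the open
complement mass at most `m / n`; the portmanteau inequality for open sets passes this to the limit.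
-/
theorem pomega_apply_eq_one {f : C(I, I)} {x : I} {K : Set I} (hK : IsClosed K) {m : ℕ}
    (h : ∀ j, m ≤ j → f^[j] x ∈ K) {μ : ProbabilityMeasure I} (hμ : μ ∈ pomega f x) :
    (μ : Measure I) K = 1 := by
  obtain ⟨φ, hφ, hμ⟩ := hμ
  rw [← prob_compl_eq_zero_iff hK.measurableSet]
  refine le_antisymm ?_ zero_le
  refine (ProbabilityMeasure.le_liminf_measure_open_of_tendsto hμ hK.isOpen_compl).trans ?_
  have h2 : ∀ k, (orbitMeasure f x (φ k) : Measure I) Kᶜ ≤ ((φ k : ℕ) : ENNReal)⁻¹ * m := by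
    intro k
    rw [orbitMeasure_eq_avgDirac, avgDirac_apply]
    gcongr
    calc ∑ j ∈ Finset.range (φ k), Measure.dirac (f^[j] x) Kᶜ
        ≤ ∑ j ∈ Finset.range (φ k), if j ∈ Finset.range m then (1 : ENNReal) else 0 := by
          refine Finset.sum_le_sum fun j _ => ?_
          rw [Measure.dirac_apply' _ hK.measurableSet.compl]
          by_cases hj : j < m
          · rw [if_pos (Finset.mem_range.2 hj)]
            exact indicator_le_self' (fun _ _ => zero_le) _
          · simp [h j (not_lt.1 hj)]
      _ ≤ m := by
          rw [Finset.sum_ite_mem]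
          simp only [Finset.sum_const, nsmul_eq_mul, mul_one]
          exact_mod_cast (Finset.card_le_card Finset.inter_subset_right).trans_eq
            (Finset.card_range m)
  have h3 : Tendsto (fun k => ((φ k : ℕ) : ENNReal)⁻¹ * m) atTop (𝓝 0) := by
    have := ENNReal.tendsto_inv_nat_nhds_zero.comp (tendsto_coe_of_strictMono hφ)
    simpa using ENNReal.Tendsto.mul_const this (b := (m : ENNReal)) (by simp)
  rw [← h3.liminf_eq]
  exact liminf_le_liminf (Eventually.of_forall h2)

/-! ### The distance between measures -/

section MeasureDist

variable (Ψ : ℕ → C(I, I))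

theorem integrable_coe (ψ : C(I, I)) (μ : ProbabilityMeasure I) :
    Integrable (fun x => (ψ x : ℝ)) (μ : Measure I) :=
  (continuous_subtype_val.comp ψ.continuous).integrable_of_hasCompactSupport
    (HasCompactSupport.of_compactSpace _)

theorem abs_integral_sub_integral_le_one (ψ : C(I, I)) (μ ν : ProbabilityMeasure I) :
    |∫ x, (ψ x : ℝ) ∂(μ : Measure I) - ∫ x, (ψ x : ℝ) ∂(ν : Measure I)| ≤ 1 := by
  have h : ∀ μ : ProbabilityMeasure I, ∫ x, (ψ x : ℝ) ∂(μ : Measure I) ∈ Icc (0 : ℝ) 1 := by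
    intro μ
    refine ⟨integral_nonneg fun x => (ψ x).2.1, ?_⟩
    calc ∫ x, (ψ x : ℝ) ∂(μ : Measure I) ≤ ∫ _, (1 : ℝ) ∂(μ : Measure I) :=
          integral_mono (integrable_coe ψ μ) (integrable_const _) fun x => (ψ x).2.2
      _ = 1 := by simp
  rw [abs_le]
  constructor <;> linarith [(h μ).1, (h μ).2, (h ν).1, (h ν).2]

theorem summable_weight : Summable fun i : ℕ => (1 / 2 ^ (i + 1) : ℝ) := by
  have := (summable_geometric_two).mul_left (1 / 2 : ℝ)
  refine this.congr fun i => ?_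
  rw [pow_succ, one_div_pow]
  field_simp

theorem tsum_weight : ∑' i : ℕ, (1 / 2 ^ (i + 1) : ℝ) = 1 := by
  have := tsum_geometric_two' 1
  refine Eq.trans (tsum_congr fun i => ?_) this
  rw [pow_succ]
  field_simp

theorem weight_mul_le (μ ν : ProbabilityMeasure I) (i : ℕ) :
    (1 / 2 ^ (i + 1) : ℝ) *
      |∫ x, (Ψ i x : ℝ) ∂(μ : Measure I) - ∫ x, (Ψ i x : ℝ) ∂(ν : Measure I)| ≤
      1 / 2 ^ (i + 1) :=
  mul_le_of_le_one_right (by positivity) (abs_integral_sub_integral_le_one _ _ _)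

theorem summable_measureDist (μ ν : ProbabilityMeasure I) :
    Summable fun i : ℕ => (1 / 2 ^ (i + 1) : ℝ) *
      |∫ x, (Ψ i x : ℝ) ∂(μ : Measure I) - ∫ x, (Ψ i x : ℝ) ∂(ν : Measure I)| :=
  Summable.of_nonneg_of_le (fun _ => by positivity) (weight_mul_le Ψ μ ν) summable_weight

theorem measureDist_self (μ : ProbabilityMeasure I) : measureDist Ψ μ μ = 0 := by
  simp [measureDist]

theorem measureDist_nonneg (μ ν : ProbabilityMeasure I) : 0 ≤ measureDist Ψ μ ν :=
  tsum_nonneg fun _ => by positivity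

theorem measureDist_comm (μ ν : ProbabilityMeasure I) :
    measureDist Ψ μ ν = measureDist Ψ ν μ := by
  simp only [measureDist, abs_sub_comm]

theorem measureDist_triangle (μ ν ρ : ProbabilityMeasure I) :
    measureDist Ψ μ ρ ≤ measureDist Ψ μ ν + measureDist Ψ ν ρ := by
  unfold measureDist
  rw [← (summable_measureDist Ψ μ ν).tsum_add (summable_measureDist Ψ ν ρ)]
  refine (summable_measureDist Ψ μ ρ).tsum_le_tsum (fun i => ?_)
    ((summable_measureDist Ψ μ ν).add (summable_measureDist Ψ ν ρ))
  rw [← mul_add]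
  gcongr
  exact abs_sub_le _ _ _

theorem continuous_measureDist (μ : ProbabilityMeasure I) :
    Continuous fun ν => measureDist Ψ ν μ := by
  refine continuous_tsum (fun i => ?_) summable_weight fun i ν => ?_
  · have := ProbabilityMeasure.continuous_integral_continuousMap
      (⟨fun x => (Ψ i x : ℝ), continuous_subtype_val.comp (Ψ i).continuous⟩ : C(I, ℝ))
    exact continuous_const.mul (this.sub continuous_const).abs
  · rw [Real.norm_of_nonneg (by positivity)]
    exact weight_mul_le Ψ ν μ i

/-- A small distance is guaranteed by finitely many integrals being close. -/
theorem exists_forall_measureDist_lt {ε : ℝ} (hε : 0 < ε) :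
    ∃ m : ℕ, ∃ δ > 0, ∀ μ ν : ProbabilityMeasure I,
      (∀ i < m, |∫ x, (Ψ i x : ℝ) ∂(μ : Measure I) - ∫ x, (Ψ i x : ℝ) ∂(ν : Measure I)| ≤ δ) →
      measureDist Ψ μ ν < ε := by
  obtain ⟨m, hm⟩ := ((tendsto_sum_nat_add fun i : ℕ => (1 / 2 ^ (i + 1) : ℝ)).eventually
    (gt_mem_nhds (half_pos hε))).exists
  refine ⟨m, ε / 2, half_pos hε, fun μ ν h => ?_⟩
  rw [measureDist, ← (summable_measureDist Ψ μ ν).sum_add_tsum_nat_add m]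
  have h1 : ∑ i ∈ Finset.range m, (1 / 2 ^ (i + 1) : ℝ) *
      |∫ x, (Ψ i x : ℝ) ∂(μ : Measure I) - ∫ x, (Ψ i x : ℝ) ∂(ν : Measure I)| ≤ ε / 2 := by
    calc _ ≤ ∑ i ∈ Finset.range m, (1 / 2 ^ (i + 1) : ℝ) * (ε / 2) := by
          refine Finset.sum_le_sum fun i hi => ?_
          gcongr
          exact h i (Finset.mem_range.1 hi)
      _ = (∑ i ∈ Finset.range m, (1 / 2 ^ (i + 1) : ℝ)) * (ε / 2) := by rw [Finset.sum_mul]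
      _ ≤ 1 * (ε / 2) := by
          gcongr
          exact (summable_weight.sum_le_tsum _ fun i _ => by positivity).trans_eq tsum_weight
      _ = ε / 2 := one_mul _
  have h2 := (((summable_nat_add_iff m).2 (summable_measureDist Ψ μ ν)).tsum_le_tsum
    (fun i => weight_mul_le Ψ μ ν (i + m)) ((summable_nat_add_iff m).2 summable_weight))
  linarith

variable {Ψ}

/-- The `i`-th integral is controlled by `2 ^ (i + 1)` times the distance. Density extends
convergence to all continuous functions with values in `[0,1]`, and an affine rescaling to all real
ones. -/
theorem tendsto_of_tendsto_measureDist (hΨ : DenseRange Ψ) {μs : ℕ → ProbabilityMeasure I}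
    {μ : ProbabilityMeasure I} (h : Tendsto (fun k => measureDist Ψ μ (μs k)) atTop (𝓝 0)) :
    Tendsto μs atTop (𝓝 μ) := by
  have hi : ∀ i, Tendsto (fun k => ∫ x, (Ψ i x : ℝ) ∂(μs k : Measure I)) atTop
      (𝓝 (∫ x, (Ψ i x : ℝ) ∂(μ : Measure I))) := by
    intro i
    rw [tendsto_iff_dist_tendsto_zero]
    have h' := h.const_mul ((2 : ℝ) ^ (i + 1))
    rw [mul_zero] at h'
    refine squeeze_zero (fun _ => dist_nonneg) (fun k => ?_) h'
    have := (summable_measureDist Ψ μ (μs k)).le_tsum i fun j _ => by positivity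
    rw [dist_comm, Real.dist_eq]
    calc _ = (2 : ℝ) ^ (i + 1) * ((1 / 2 ^ (i + 1) : ℝ) *
      |∫ x, (Ψ i x : ℝ) ∂(μ : Measure I) - ∫ x, (Ψ i x : ℝ) ∂(μs k : Measure I)|) := by
          field_simp
      _ ≤ _ := by gcongr; exact this
  have hχ : ∀ χ : C(I, I), Tendsto (fun k => ∫ x, (χ x : ℝ) ∂(μs k : Measure I)) atTop
      (𝓝 (∫ x, (χ x : ℝ) ∂(μ : Measure I))) := by
    intro χ
    rw [Metric.tendsto_atTop]
    intro ε hε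
    obtain ⟨i, hχi⟩ := hΨ.exists_dist_lt χ (show 0 < ε / 3 by positivity)
    obtain ⟨N, hN⟩ := Metric.tendsto_atTop.1 (hi i) (ε / 3) (by positivity)
    refine ⟨N, fun k hk => ?_⟩
    have hd : ∀ ν : ProbabilityMeasure I,
        dist (∫ x, (χ x : ℝ) ∂(ν : Measure I)) (∫ x, (Ψ i x : ℝ) ∂(ν : Measure I)) ≤ ε / 3 := by
      intro ν
      rw [dist_eq_norm, ← integral_sub (integrable_coe _ _) (integrable_coe _ _)]
      refine (norm_integral_le_of_norm_le_const (C := ε / 3)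
        (Eventually.of_forall fun x => ?_)).trans (by simp)
      exact (ContinuousMap.dist_apply_le_dist x).trans hχi.le
    have h1 := hd (μs k)
    have h2 := hd μ
    have h3 := hN k hk
    rw [dist_comm] at h2
    have h4 := dist_triangle4 (∫ x, (χ x : ℝ) ∂(μs k : Measure I))
      (∫ x, (Ψ i x : ℝ) ∂(μs k : Measure I)) (∫ x, (Ψ i x : ℝ) ∂(μ : Measure I))
      (∫ x, (χ x : ℝ) ∂(μ : Measure I))
    linarith
  rw [ProbabilityMeasure.tendsto_iff_forall_integral_tendsto]
  intro φ
  have hM : 0 < ‖φ‖ + 1 := by positivity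
  have hmem : ∀ x, (φ x + (‖φ‖ + 1)) / (2 * (‖φ‖ + 1)) ∈ Icc (0 : ℝ) 1 := by
    intro x
    have := abs_le.1 ((Real.norm_eq_abs _).symm.trans_le (φ.norm_coe_le_norm x))
    constructor
    · apply div_nonneg <;> linarith [this.1]
    · rw [div_le_one (by positivity)]
      linarith [this.2]
  have h1 := hχ ⟨fun x => ⟨_, hmem x⟩, by fun_prop⟩
  have key : ∀ ν : ProbabilityMeasure I, ∫ x, φ x ∂(ν : Measure I) =
      2 * (‖φ‖ + 1) * (∫ x, (φ x + (‖φ‖ + 1)) / (2 * (‖φ‖ + 1)) ∂(ν : Measure I)) -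
        (‖φ‖ + 1) := by
    intro ν
    rw [integral_div, integral_add (φ.integrable _) (integrable_const _)]
    simp
    field_simp
    ring
  simp only [key]
  exact (h1.const_mul _).sub_const _

theorem mem_closure_of_measureDist (hΨ : DenseRange Ψ) {S : Set (ProbabilityMeasure I)}
    {μ : ProbabilityMeasure I} (h : ∀ ε > 0, ∃ ν ∈ S, measureDist Ψ μ ν < ε) :
    μ ∈ closure S := by
  choose ν hνS hν using fun k : ℕ => h (1 / (k + 1)) (by positivity)
  exact mem_closure_of_tendsto (tendsto_of_tendsto_measureDist hΨ
    (squeeze_zero (fun _ => measureDist_nonneg _ _ _) (fun k => (hν k).le)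
      tendsto_one_div_add_atTop_nhds_zero_nat)) (Eventually.of_forall hνS)

theorem exists_measureDist_lt_of_mem_closure (Ψ : ℕ → C(I, I)) {S : Set (ProbabilityMeasure I)}
    {μ : ProbabilityMeasure I} (h : μ ∈ closure S) {ε : ℝ} (hε : 0 < ε) :
    ∃ ν ∈ S, measureDist Ψ ν μ < ε := by
  obtain ⟨ν, hν, hνS⟩ := mem_closure_iff.1 h {ν | measureDist Ψ ν μ < ε}
    (isOpen_lt (continuous_measureDist Ψ μ) continuous_const)
    (by simpa [measureDist_self] using hε)
  exact ⟨ν, hνS, hν⟩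

end MeasureDist

/-! ### Periodic shrinking intervals -/

theorem isCompact_image_iterate (f : C(I, I)) (j : ℕ) (a b : I) :
    IsCompact (f^[j] '' Icc a b) :=
  isCompact_Icc.image (f.continuous.iterate j)

theorem isClosed_orbitSet (f : C(I, I)) (a b : I) (p : ℕ) : IsClosed (orbitSet f a b p) :=
  isClosed_biUnion_finset fun j _ => (isCompact_image_iterate f j a b).isClosed

namespace IsPeriodicShrinking

variable {f : C(I, I)} {a b : I} {p : ℕ}

theorem mapsTo (h : IsPeriodicShrinking f a b p) : MapsTo f^[p] (Icc a b) (Icc a b) :=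
  fun _ hx => Ioo_subset_Icc_self (h.image_subset (mem_image_of_mem _ hx))

theorem iterate_mem (h : IsPeriodicShrinking f a b p) {y : I} (hy : y ∈ Icc a b) (k : ℕ) :
    f^[k] y ∈ f^[k % p] '' Icc a b := by
  refine ⟨f^[p * (k / p)] y, ?_, ?_⟩
  · rw [Function.iterate_mul]
    exact h.mapsTo.iterate _ hy
  · rw [← Function.iterate_add_apply, Nat.mod_add_div]

theorem iterate_mem_orbitSet (h : IsPeriodicShrinking f a b p) {y : I} (hy : y ∈ Icc a b) {k : ℕ}
    (hk : 1 ≤ k) : f^[k] y ∈ orbitSet f a b p := by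
  simp only [orbitSet, Finset.mem_Icc, mem_iUnion]
  have hp := h.one_le
  -- `orbitSet` is indexed by `1, …, p`, so the remainder is taken of `k - 1` and shifted back.
  refine ⟨(k - 1) % p + 1, ⟨by omega, Nat.mod_lt _ (by omega)⟩, f^[p * ((k - 1) / p)] y, ?_, ?_⟩
  · rw [Function.iterate_mul]
    exact h.mapsTo.iterate _ hy
  · rw [← Function.iterate_add_apply]
    congr 2
    have := Nat.mod_add_div (k - 1) p
    omega

theorem dist_le (h : IsPeriodicShrinking f a b p) {j : ℕ} (hj : j < p) {u v : I}
    (hu : u ∈ f^[j] '' Icc a b) (hv : v ∈ f^[j] '' Icc a b) : dist u v ≤ b - a := by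
  obtain ⟨x, hx, rfl⟩ := hu
  obtain ⟨y, hy, rfl⟩ := hv
  rcases Nat.eq_zero_or_pos j with rfl | hj0
  · rw [Subtype.dist_eq]
    exact Real.dist_le_of_mem_Icc ⟨hx.1, hx.2⟩ ⟨hy.1, hy.2⟩
  · have hc : Icc a b ⊆ closure (Ioo a b) := (closure_Ioo h.lt.ne).ge
    have hcl : f^[j] '' Icc a b ⊆ closure (f^[j] '' Ioo a b) :=
      (image_mono hc).trans (image_closure_subset_closure_image (f.continuous.iterate j))
    calc dist (f^[j] x) (f^[j] y) ≤ Metric.diam (closure (f^[j] '' Ioo a b)) :=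
          Metric.dist_le_diam_of_mem Metric.isBounded_of_compactSpace
            (hcl (mem_image_of_mem _ hx)) (hcl (mem_image_of_mem _ hy))
      _ ≤ b - a := by
          rw [Metric.diam_closure]
          exact (h.length_lt j hj0 (by omega)).le

/-- The intermediate value theorem gives a fixed point of `f^[p]`; a smaller period would put it in
two of the disjoint images. -/
theorem exists_minimalPeriod_eq (h : IsPeriodicShrinking f a b p) :
    ∃ z ∈ Ioo a b, Function.minimalPeriod f z = p := by
  obtain ⟨z, hz, hfix⟩ := exists_mem_Icc_isFixedPt_of_mapsTo
    (f.continuous.iterate p).continuousOn h.lt.le h.mapsTo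
  refine ⟨z, hfix ▸ h.image_subset (mem_image_of_mem _ hz), ?_⟩
  have hper : Function.IsPeriodicPt f p z := hfix
  have hpos := hper.minimalPeriod_pos h.one_le
  refine le_antisymm (hper.minimalPeriod_le h.one_le) (not_lt.1 fun hlt => ?_)
  have hd := h.disjoint 0 h.one_le _ hlt hpos.ne
  exact disjoint_left.1 hd ⟨z, hz, rfl⟩ ⟨z, hz, Function.iterate_minimalPeriod⟩

theorem orbitMeasure_orbitSet (h : IsPeriodicShrinking f a b p) {z : I} (hz : z ∈ Icc a b)
    (n : ℕ+) (hn : f^[n] z = z) : (orbitMeasure f z n : Measure I) (orbitSet f a b p) = 1 := by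
  refine avgDirac_apply_eq_one (isClosed_orbitSet f a b p).measurableSet fun j _ => ?_
  have : f^[j] z = f^[j + n] z := by rw [Function.iterate_add_apply, hn]
  rw [this]
  exact h.iterate_mem_orbitSet hz (by have := n.pos; omega)

end IsPeriodicShrinking

/-! ### Invariant measures on the orbit of a shrinking interval -/

theorem sum_range_add_mod (F : ℕ → ℝ) (p l : ℕ) :
    ∑ j ∈ Finset.range p, F ((j + l) % p) = ∑ j ∈ Finset.range p, F j := by
  induction l with
  | zero =>
    exact Finset.sum_congr rfl fun j hj => by
      rw [add_zero, Nat.mod_eq_of_lt (Finset.mem_range.1 hj)]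
  | succ l ih =>
    have h1 := Finset.sum_range_succ (fun j => F ((j + l) % p)) p
    have h2 := Finset.sum_range_succ' (fun j => F ((j + l) % p)) p
    simp only [zero_add, Nat.add_mod_left] at h1 h2
    simp only [show ∀ j, j + (l + 1) = j + 1 + l by intro j; ring]
    linarith

/-- A point of the `l`-th image visits the images in the same cyclic order as `z`, shifted by `l`.
After the shift, matched points share an image, so they are at distance at most `b - a`. -/
theorem IsPeriodicShrinking.abs_average_sub_le {f : C(I, I)} {a b : I} {p : ℕ}
    (h : IsPeriodicShrinking f a b p) {φ : I → ℝ} {ε : ℝ}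
    (hφ : ∀ u v : I, dist u v ≤ b - a → |φ u - φ v| ≤ ε) {x z : I}
    (hx : x ∈ orbitSet f a b p) (hz : z ∈ Icc a b) :
    |(p : ℝ)⁻¹ * ∑ j ∈ Finset.range p, φ (f^[j] x) -
      (p : ℝ)⁻¹ * ∑ j ∈ Finset.range p, φ (f^[j] z)| ≤ ε := by
  simp only [orbitSet, Finset.mem_Icc, mem_iUnion] at hx
  obtain ⟨l, -, y, hy, rfl⟩ := hx
  have hp := h.one_le
  have hp0 : (0 : ℝ) < p := by exact_mod_cast hp
  rw [← sum_range_add_mod (fun j => φ (f^[j] z)) p l, ← mul_sub, ← Finset.sum_sub_distrib,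
    abs_mul, abs_of_pos (inv_pos.2 hp0), inv_mul_le_iff₀ hp0]
  calc _ ≤ ∑ j ∈ Finset.range p, |φ (f^[j] (f^[l] y)) - φ (f^[(j + l) % p] z)| :=
        Finset.abs_sum_le_sum_abs _ _
    _ ≤ ∑ j ∈ Finset.range p, ε := by
        refine Finset.sum_le_sum fun j _ => hφ _ _ ?_
        rw [← Function.iterate_add_apply]
        exact h.dist_le (Nat.mod_lt _ hp) (h.iterate_mem hy _) (mem_image_of_mem _ hz)
    _ = p * ε := by simp

theorem integral_comp_iterate {f : C(I, I)} {μ : ProbabilityMeasure I}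
    (hμ : μ ∈ invariantMeasures f) {φ : I → ℝ} (hφ : Continuous φ) (j : ℕ) :
    ∫ x, φ (f^[j] x) ∂(μ : Measure I) = ∫ x, φ x ∂(μ : Measure I) := by
  have h : MeasurePreserving f^[j] (μ : Measure I) (μ : Measure I) :=
    MeasurePreserving.iterate hμ j
  conv_rhs => rw [← h.map_eq]
  rw [integral_map h.measurable.aemeasurable hφ.aestronglyMeasurable]

theorem continuous_integrable {φ : I → ℝ} (hφ : Continuous φ) (μ : ProbabilityMeasure I) :
    Integrable φ (μ : Measure I) :=
  hφ.integrable_of_hasCompactSupport (HasCompactSupport.of_compactSpace _)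

theorem integral_average {f : C(I, I)} {μ : ProbabilityMeasure I}
    (hμ : μ ∈ invariantMeasures f) {φ : I → ℝ} (hφ : Continuous φ) {p : ℕ} (hp : 1 ≤ p) :
    ∫ x, (p : ℝ)⁻¹ * ∑ j ∈ Finset.range p, φ (f^[j] x) ∂(μ : Measure I) =
      ∫ x, φ x ∂(μ : Measure I) := by
  have hp0 : (p : ℝ) ≠ 0 := by positivity
  rw [integral_const_mul, integral_finsetSum _
    fun j _ => continuous_integrable (φ := fun x => φ (f^[j] x))
      (hφ.comp (f.continuous.iterate j)) μ]
  simp only [integral_comp_iterate hμ hφ]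
  simp [hp0]

/-- By invariance `φ` may be replaced by its average over one period, which on the orbit set is
within `ε` of its value at `z`. -/
theorem IsPeriodicShrinking.abs_integral_sub_le {f : C(I, I)} {a b : I} {p : ℕ+}
    (h : IsPeriodicShrinking f a b p) {φ : I → ℝ} (hφc : Continuous φ) {ε : ℝ}
    (hφ : ∀ u v : I, dist u v ≤ b - a → |φ u - φ v| ≤ ε) {z : I} (hz : z ∈ Icc a b)
    {μ : ProbabilityMeasure I} (hμ : μ ∈ invariantMeasures f)
    (hμ1 : (μ : Measure I) (orbitSet f a b p) = 1) :
    |∫ x, φ x ∂(μ : Measure I) - ∫ x, φ x ∂(orbitMeasure f z p : Measure I)| ≤ ε := by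
  rw [← integral_average hμ hφc p.pos, integral_orbitMeasure]
  have hae : ∀ᵐ x ∂(μ : Measure I), x ∈ orbitSet f a b p := by
    rw [← prob_compl_eq_zero_iff (isClosed_orbitSet f a b p).measurableSet] at hμ1
    exact hμ1
  have hint : Integrable (fun x => ((p : ℕ) : ℝ)⁻¹ * ∑ j ∈ Finset.range p, φ (f^[j] x))
      (μ : Measure I) := by
    refine continuous_integrable ?_ μ
    exact continuous_const.mul
      (continuous_finsetSum _ fun j _ => hφc.comp (f.continuous.iterate j))
  set c : ℝ := ((p : ℕ) : ℝ)⁻¹ * ∑ j ∈ Finset.range p, φ (f^[j] z) with hc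
  have hconst : c = ∫ _, c ∂(μ : Measure I) := by simp
  rw [hconst, ← integral_sub hint (integrable_const _), ← Real.norm_eq_abs]
  refine (norm_integral_le_of_norm_le_const (C := ε) (hae.mono fun x hx => ?_)).trans (by simp)
  exact h.abs_average_sub_le hφ hx hz

/-- All invariant measures carried by the orbit of a short periodic shrinking interval are close to
each other. -/
theorem exists_forall_isPeriodicShrinking_measureDist_lt (Ψ : ℕ → C(I, I)) {ε : ℝ} (hε : 0 < ε) :
    ∃ q : ℕ, 1 ≤ q ∧ ∀ (f : C(I, I)) (a b : I) (p : ℕ+), IsPeriodicShrinking f a b p →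
      (b : ℝ) - a < 1 / q → ∀ z ∈ Icc a b, ∀ μ ∈ invariantMeasures f,
      (μ : Measure I) (orbitSet f a b p) = 1 → measureDist Ψ μ (orbitMeasure f z p) < ε := by
  obtain ⟨m, δ, hδ, hm⟩ := exists_forall_measureDist_lt Ψ hε
  have hev : ∀ i, ∃ η > 0, ∀ ⦃u v : I⦄, dist u v < η → dist (Ψ i u) (Ψ i v) < δ := fun i =>
    Metric.uniformContinuous_iff.1
      (CompactSpace.uniformContinuous_of_continuous (Ψ i).continuous) δ hδ
  choose η hη hηd using hev
  have hq : ∀ᶠ q : ℕ in atTop, ∀ i ∈ Finset.range m, 1 / (q : ℝ) < η i := by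
    rw [Filter.eventually_all_finset]
    intro i _
    exact tendsto_one_div_atTop_nhds_zero_nat.eventually (gt_mem_nhds (hη i))
  obtain ⟨q, hq, hq1⟩ := (hq.and (eventually_ge_atTop 1)).exists
  refine ⟨q, hq1, fun f a b p h hab z hz μ hμ hμ1 => hm _ _ fun i hi => ?_⟩
  refine h.abs_integral_sub_le (continuous_subtype_val.comp (Ψ i).continuous) ?_ hz hμ hμ1
  intro u v huv
  have := hηd i (huv.trans_lt (hab.trans (hq i (Finset.mem_range.2 hi))))
  exact this.le

/-! ### Stability under perturbation -/

theorem eventually_forall_mem_of_isCompact {Y : Type*} [TopologicalSpace Y] {K : Set Y}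
    (hK : IsCompact K) {f : C(I, I)} {s : Set (C(I, I) × Y)} (hs : IsOpen s)
    (h : ∀ y ∈ K, (f, y) ∈ s) : ∀ᶠ g in 𝓝 f, ∀ y ∈ K, (g, y) ∈ s :=
  hK.eventually_forall_of_forall_eventually fun y hy => hs.mem_nhds (h y hy)

/-- Each requirement can be expressed as an open condition on points of a compact set, so it
persists for nearby maps with the same `a`, `b` and `p`. -/
theorem IsPeriodicShrinking.eventually {f : C(I, I)} {a b : I} {p : ℕ}
    (h : IsPeriodicShrinking f a b p) : ∀ᶠ g in 𝓝 f, IsPeriodicShrinking g a b p := by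
  have hfst : ∀ j, Continuous fun q : C(I, I) × (I × I) => q.1^[j] q.2.1 := fun j =>
    (continuous_iterate_apply j).comp (continuous_fst.prodMk (continuous_fst.comp continuous_snd))
  have hsnd : ∀ j, Continuous fun q : C(I, I) × (I × I) => q.1^[j] q.2.2 := fun j =>
    (continuous_iterate_apply j).comp (continuous_fst.prodMk (continuous_snd.comp continuous_snd))
  have hK : IsCompact (Icc a b ×ˢ Icc a b) := isCompact_Icc.prod isCompact_Icc
  have h1 : ∀ᶠ g : C(I, I) in 𝓝 f, ∀ i ∈ Finset.range p, ∀ j ∈ Finset.range p, i ≠ j →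
      ∀ y ∈ Icc a b ×ˢ Icc a b, g^[i] y.1 ≠ g^[j] y.2 := by
    simp only [Filter.eventually_all_finset, Filter.eventually_imp_distrib_left]
    intro i hi j hj hij
    refine eventually_forall_mem_of_isCompact hK (s := {q | q.1^[i] q.2.1 ≠ q.1^[j] q.2.2})
      (isOpen_ne_fun (hfst i) (hsnd j)) fun y hy => ?_
    exact (h.disjoint i (Finset.mem_range.1 hi) j (Finset.mem_range.1 hj) hij).ne_of_mem
      (mem_image_of_mem _ hy.1) (mem_image_of_mem _ hy.2)
  have h2 : ∀ᶠ g : C(I, I) in 𝓝 f, ∀ y ∈ Icc a b, g^[p] y ∈ Ioo a b :=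
    eventually_forall_mem_of_isCompact isCompact_Icc (s := {q | q.1^[p] q.2 ∈ Ioo a b})
      (isOpen_Ioo.preimage (continuous_iterate_apply p))
      fun y hy => h.image_subset (mem_image_of_mem _ hy)
  have h3 : ∀ᶠ g : C(I, I) in 𝓝 f, ∀ j ∈ Finset.Icc 1 (p - 1),
      Metric.diam (g^[j] '' Ioo a b) < (b : ℝ) - a := by
    rw [Filter.eventually_all_finset]
    intro j hj
    rw [Finset.mem_Icc] at hj
    have hlt := h.length_lt j hj.1 hj.2
    -- Pointwise bounds on distances only give a non-strict bound on the diameter; the intermediate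
    -- `c` keeps it strictly below `b - a`.
    obtain ⟨c, hc1, hc2⟩ := exists_between hlt
    have hc : Icc a b ⊆ closure (Ioo a b) := (closure_Ioo h.lt.ne).ge
    have hcl : f^[j] '' Icc a b ⊆ closure (f^[j] '' Ioo a b) :=
      (image_mono hc).trans (image_closure_subset_closure_image (f.continuous.iterate j))
    have := eventually_forall_mem_of_isCompact hK (f := f)
      (s := {q | dist (q.1^[j] q.2.1) (q.1^[j] q.2.2) < c})
      (isOpen_lt ((hfst j).dist (hsnd j)) continuous_const) fun y hy =>
        (Metric.dist_le_diam_of_mem Metric.isBounded_of_compactSpace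
            (hcl (mem_image_of_mem _ hy.1)) (hcl (mem_image_of_mem _ hy.2))).trans_lt
          (by rwa [Metric.diam_closure])
    filter_upwards [this] with g hg
    refine (Metric.diam_le_of_forall_dist_le (Metric.diam_nonneg.trans hc1.le) ?_).trans_lt hc2
    rintro _ ⟨x, hx, rfl⟩ _ ⟨y, hy, rfl⟩
    exact (hg (x, y) ⟨Ioo_subset_Icc_self hx, Ioo_subset_Icc_self hy⟩).le
  filter_upwards [h1, h2, h3] with g h1 h2 h3
  refine ⟨h.lt, h.one_le, fun i hi j hj hij => ?_, ?_, fun j hj hj' =>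
    h3 j (Finset.mem_Icc.2 ⟨hj, hj'⟩)⟩
  · rw [Set.disjoint_left]
    rintro _ ⟨x, hx, rfl⟩ ⟨y, hy, hxy⟩
    exact h1 i (Finset.mem_range.2 hi) j (Finset.mem_range.2 hj) hij (x, y) ⟨hx, hy⟩ hxy.symm
  · rintro _ ⟨x, hx, rfl⟩
    exact h2 x hx

/-! ### Locally constant perturbations -/

/-- A map can be made constant around finitely many separated points by a perturbation which is
small when the new values are close to the old ones. -/
theorem exists_perturbation (f : C(I, I)) {r r' η : ℝ} (hr : r < r') (hη : 0 ≤ η) (t : I → I)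
    (F : Finset I) (hsep : ∀ y ∈ F, ∀ z ∈ F, y ≠ z → r + r' ≤ dist y z)
    (hosc : ∀ y ∈ F, ∀ x, dist x y ≤ r' → dist (t y) (f x) ≤ η) :
    ∃ g : C(I, I), (∀ x, dist (g x) (f x) ≤ η) ∧ ∀ y ∈ F, ∀ x, dist x y ≤ r → g x = t y := by
  induction F using Finset.induction_on with
  | empty => exact ⟨f, by simpa using hη, by simp⟩
  | insert y F hy ih =>
    obtain ⟨g, hgf, hg⟩ := ih
      (fun u hu v hv => hsep u (Finset.mem_insert_of_mem hu) v (Finset.mem_insert_of_mem hv))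
      (fun u hu => hosc u (Finset.mem_insert_of_mem hu))
    have hrr : 0 < r' - r := sub_pos.2 hr
    -- A cutoff equal to `1` within `r` of `y` and `0` beyond `r'`. Interpolating towards `t y`
    -- stays within `η` of `f` by convexity, and by the separation `r + r'` leaves the values near
    -- the other points untouched.
    let χ : I → ℝ := fun x => max 0 (min 1 ((r' - dist x y) / (r' - r)))
    have hχc : Continuous χ := by fun_prop
    have hχ0 : ∀ x, 0 ≤ χ x := fun x => le_max_left _ _
    have hχ1 : ∀ x, χ x ≤ 1 := fun x => max_le zero_le_one (min_le_left _ _)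
    have hone : ∀ x, dist x y ≤ r → χ x = 1 := by
      intro x hx
      have : 1 ≤ (r' - dist x y) / (r' - r) := by
        rw [le_div_iff₀ hrr]
        linarith
      simp only [χ, min_eq_left this]
      simp
    have hzero : ∀ x, r' ≤ dist x y → χ x = 0 := by
      intro x hx
      have : (r' - dist x y) / (r' - r) ≤ 0 :=
        div_nonpos_of_nonpos_of_nonneg (by linarith) hrr.le
      exact max_eq_left ((min_le_right _ _).trans this)
    have hmem : ∀ x, (1 - χ x) * (g x : ℝ) + χ x * (t y : ℝ) ∈ Icc (0 : ℝ) 1 := fun x =>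
      convex_Icc (0 : ℝ) 1 (g x).2 (t y).2 (by linarith [hχ1 x]) (hχ0 x) (by ring)
    refine ⟨⟨fun x => ⟨_, hmem x⟩, by fun_prop⟩, fun x => ?_, fun z hz x hx => ?_⟩
    · rw [Subtype.dist_eq, Real.dist_eq]
      change |(1 - χ x) * (g x : ℝ) + χ x * (t y : ℝ) - f x| ≤ η
      rcases le_total r' (dist x y) with h | h
      · rw [hzero x h]
        simpa [Subtype.dist_eq, Real.dist_eq] using hgf x
      · have h1 : |(g x : ℝ) - f x| ≤ η := hgf x
        have h2 : |(t y : ℝ) - f x| ≤ η := hosc y (Finset.mem_insert_self _ _) x h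
        rw [abs_le] at *
        constructor <;> nlinarith [hχ0 x, hχ1 x, h1.1, h1.2, h2.1, h2.2]
    · apply Subtype.ext
      change (1 - χ x) * (g x : ℝ) + χ x * (t y : ℝ) = t z
      rcases eq_or_ne z y with rfl | hzy
      · rw [hone x hx]
        ring
      · have hzF : z ∈ F := (Finset.mem_insert.1 hz).resolve_left hzy
        have h1 := hsep z hz y (Finset.mem_insert_self _ _) hzy
        have h2 := dist_triangle z x y
        rw [dist_comm z x] at h2
        rw [hzero x (by linarith), hg z hzF x hx]
        ring

/-- Around each point `y` of the finite set `F` the map `g` takes the constant value `t y ∈ F`. -/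
structure IsFiniteModel (g : C(I, I)) (F : Finset I) (t : I → I) (r : ℝ) : Prop where
  pos : 0 < r
  mapsTo : MapsTo t F F
  sep : ∀ y ∈ F, ∀ z ∈ F, y ≠ z → r < dist y z
  const : ∀ y ∈ F, ∀ x, dist x y ≤ r → g x = t y

namespace IsFiniteModel

variable {g : C(I, I)} {F : Finset I} {t : I → I} {r : ℝ}

theorem iterate_apply (h : IsFiniteModel g F t r) {y : I} (hy : y ∈ F) (j : ℕ) :
    g^[j] y = t^[j] y := by
  induction j with
  | zero => rfl
  | succ j ih =>
    rw [Function.iterate_succ_apply', Function.iterate_succ_apply', ih,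
      h.const _ (h.mapsTo.iterate j hy) _ (by simpa using h.pos.le)]

theorem iterate_apply_of_dist_le (h : IsFiniteModel g F t r) {x y : I} (hy : y ∈ F)
    (hx : dist x y ≤ r) {j : ℕ} (hj : 1 ≤ j) : g^[j] x = t^[j] y := by
  obtain ⟨k, rfl⟩ := Nat.exists_eq_add_of_le' hj
  rw [Function.iterate_succ_apply, Function.iterate_succ_apply, h.const y hy x hx,
    h.iterate_apply (h.mapsTo hy)]

/-- Every positive iterate of `g` collapses `[a, b]` to a single point of the `t`-cycle of `y`.
These points are distinct, and those other than `y` lie outside the ball of radius `r` around `y`.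
-/
theorem isPeriodicShrinking (h : IsFiniteModel g F t r) {a b y : I} (hy : y ∈ F)
    (hper : y ∈ Function.periodicPts t) (hay : a < y) (hyb : y < b)
    (hab : Icc a b ⊆ Metric.closedBall y r) :
    IsPeriodicShrinking g a b (Function.minimalPeriod t y) := by
  have hab' : a < b := hay.trans hyb
  have hpos := Function.minimalPeriod_pos_of_mem_periodicPts hper
  have himg : ∀ j, 1 ≤ j → ∀ x ∈ Icc a b, g^[j] x = t^[j] y := fun j hj x hx =>
    h.iterate_apply_of_dist_le hy (hab hx) hj
  have hinj : ∀ i < Function.minimalPeriod t y, ∀ j < Function.minimalPeriod t y, i ≠ j →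
      t^[i] y ≠ t^[j] y := fun i hi j hj hij heq =>
    hij (Function.iterate_injOn_Iio_minimalPeriod hi hj heq)
  refine ⟨hab', hpos, fun i hi j hj hij => ?_, ?_, fun j hj _ => ?_⟩
  · have main : ∀ j, 1 ≤ j → j < Function.minimalPeriod t y → ∀ x ∈ Icc a b, ∀ x' ∈ Icc a b,
        x ≠ g^[j] x' := by
      intro j hj hjp x hx x' hx' hxx
      rw [himg j hj x' hx'] at hxx
      have h1 := h.sep (t^[j] y) (h.mapsTo.iterate j hy) y hy
        (hinj j hjp 0 hpos (by omega))
      have h2 : dist x y ≤ r := hab hx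
      rw [hxx] at h2
      exact absurd h2 (not_le.2 h1)
    rw [Set.disjoint_left]
    rintro _ ⟨x, hx, rfl⟩ ⟨x', hx', hxx⟩
    rcases Nat.eq_zero_or_pos i with rfl | hi0
    · exact main j (by omega) hj x hx x' hx' hxx.symm
    · rcases Nat.eq_zero_or_pos j with rfl | hj0
      · exact main i hi0 hi x' hx' x hx hxx
      · rw [himg i hi0 x hx, himg j hj0 x' hx'] at hxx
        exact hinj i hi j hj hij hxx.symm
  · rintro _ ⟨x, hx, rfl⟩
    rw [himg _ hpos x hx, Function.iterate_minimalPeriod]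
    exact ⟨hay, hyb⟩
  · have : g^[j] '' Ioo a b ⊆ {t^[j] y} := by
      rintro _ ⟨x, hx, rfl⟩
      exact himg j hj x (Ioo_subset_Icc_self hx)
    rw [Metric.diam_subsingleton (subsingleton_singleton.anti this)]
    exact sub_pos.2 hab'

end IsFiniteModel

/-! ### Choosing points and intervals -/

theorem exists_Ioo_subset {y : I} (hy : y ∈ Ioo (0 : I) 1) {N : Set I} (hN : N ∈ 𝓝 y) :
    ∃ a b, a < y ∧ y < b ∧ Ioo a b ⊆ N := by
  obtain ⟨a, b, hab, h⟩ := (mem_nhds_iff_exists_Ioo_subset' ⟨0, hy.1⟩ ⟨1, hy.2⟩).1 hN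
  exact ⟨a, b, hab.1, hab.2, h⟩

theorem exists_Icc_subset {y : I} (hy : y ∈ Ioo (0 : I) 1) {N : Set I} (hN : N ∈ 𝓝 y) {δ : ℝ}
    (hδ : 0 < δ) : ∃ a b, a < y ∧ y < b ∧ Icc a b ⊆ N ∧ (b : ℝ) - a < δ := by
  obtain ⟨a, b, ha, hb, h⟩ := exists_Ioo_subset hy
    (inter_mem hN (Metric.ball_mem_nhds y (half_pos hδ)))
  obtain ⟨a', ha', ha'y⟩ := exists_between ha
  obtain ⟨b', hyb', hb'⟩ := exists_between hb
  have hsub : Icc a' b' ⊆ Ioo a b := Icc_subset_Ioo ha' hb'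
  have hab : a' ≤ b' := (ha'y.trans hyb').le
  refine ⟨a', b', ha'y, hyb', fun x hx => (h (hsub hx)).1, ?_⟩
  have h1 : dist a' y < δ / 2 := (h (hsub (left_mem_Icc.2 hab))).2
  have h2 : dist b' y < δ / 2 := (h (hsub (right_mem_Icc.2 hab))).2
  rw [Subtype.dist_eq, Real.dist_eq, abs_lt] at h1 h2
  linarith [h1.1, h2.2]

/-- Allows orbit points, possibly repeated or at an endpoint, to be replaced by distinct nearby
interior points. -/
theorem infinite_inter_Ioo {c : I} {N : Set I} (hN : N ∈ 𝓝 c) : (N ∩ Ioo 0 1).Infinite := by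
  have hc : c ∈ closure (Ioo (0 : I) 1) := by
    rw [closure_Ioo zero_ne_one]
    exact ⟨nonneg', le_one'⟩
  obtain ⟨y, hyN, hy⟩ := mem_closure_iff_nhds.1 hc _ (interior_mem_nhds.2 hN)
  obtain ⟨a, b, ha, hb, h⟩ := exists_Ioo_subset hy
    (inter_mem (isOpen_interior.mem_nhds hyN) (isOpen_Ioo.mem_nhds hy))
  exact (Ioo_infinite (ha.trans hb)).mono
    fun x hx => ⟨interior_subset (h hx).1, (h hx).2⟩

theorem exists_injOn_of_infinite {α : Type*} {S : ℕ → Set α} (hS : ∀ i, (S i).Infinite) (n : ℕ) :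
    ∃ y : ℕ → α, InjOn y (Iio n) ∧ ∀ i, y i ∈ S i := by
  classical
  induction n with
  | zero =>
    choose y hy using fun i => (hS i).nonempty
    exact ⟨y, by simp, hy⟩
  | succ n ih =>
    obtain ⟨y, hinj, hy⟩ := ih
    obtain ⟨w, hw, hwn⟩ := (hS n).exists_notMem_finset ((Finset.range n).image y)
    have hne : ∀ i < n, y i ≠ w := fun i hi h =>
      hwn (Finset.mem_image.2 ⟨i, Finset.mem_range.2 hi, h⟩)
    refine ⟨Function.update y n w, fun i hi j hj hij => ?_, fun i => ?_⟩
    · rcases eq_or_ne i n with hin | hin <;> rcases eq_or_ne j n with hjn | hjn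
      · exact hin.trans hjn.symm
      · simp only [hin, Function.update_self, Function.update_of_ne hjn] at hij
        exact absurd hij.symm (hne j (lt_of_le_of_ne (Nat.lt_succ_iff.1 hj) hjn))
      · simp only [hjn, Function.update_self, Function.update_of_ne hin] at hij
        exact absurd hij (hne i (lt_of_le_of_ne (Nat.lt_succ_iff.1 hi) hin))
      · simp only [Function.update_of_ne hin, Function.update_of_ne hjn] at hij
        exact hinj (lt_of_le_of_ne (Nat.lt_succ_iff.1 hi) hin)
          (lt_of_le_of_ne (Nat.lt_succ_iff.1 hj) hjn) hij
    · rcases eq_or_ne i n with rfl | hin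
      · simpa using hw
      · simpa [Function.update_of_ne hin] using hy i

theorem exists_pos_forall_lt_dist (F : Finset I) {ρ₀ : ℝ} (hρ₀ : 0 < ρ₀) :
    ∃ ρ > 0, ρ < ρ₀ ∧ ∀ y ∈ F, ∀ z ∈ F, y ≠ z → 2 * ρ < dist y z := by
  have h : ∀ᶠ ρ in 𝓝[>] (0 : ℝ), ∀ y ∈ F, ∀ z ∈ F, y ≠ z → 2 * ρ < dist y z := by
    simp only [Filter.eventually_all_finset, Filter.eventually_imp_distrib_left]
    intro y _ z _ hyz
    have h1 : Tendsto (fun ρ : ℝ => 2 * ρ) (𝓝[>] 0) (𝓝 (2 * 0)) :=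
      (continuous_const.mul continuous_id).continuousAt.tendsto.mono_left nhdsWithin_le_nhds
    rw [mul_zero] at h1
    exact h1.eventually (gt_mem_nhds (dist_pos.2 hyz))
  have h2 : ∀ᶠ ρ in 𝓝[>] (0 : ℝ), ρ < ρ₀ :=
    (gt_mem_nhds hρ₀).filter_mono nhdsWithin_le_nhds
  obtain ⟨ρ, ⟨h, h2⟩, hρ⟩ := ((h.and h2).and self_mem_nhdsWithin).exists
  exact ⟨ρ, hρ, h2, h⟩

/-! ### Maps with a periodic shrinking interval whose orbit measures are prescribed -/

/-- The maps having a periodic shrinking interval of length less than `1/q` whose points, paired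
with their orbit measures, lie in `W`. -/
def shrinkingIn (W : Set (I × ProbabilityMeasure I)) (q : ℕ) : Set C(I, I) :=
  {f | ∃ (a b : I) (p : ℕ+), IsPeriodicShrinking f a b p ∧ (b : ℝ) - a < 1 / q ∧
    ∀ x ∈ Icc a b, (x, orbitMeasure f x p) ∈ W}

theorem isOpen_shrinkingIn {W : Set (I × ProbabilityMeasure I)} (hW : IsOpen W) (q : ℕ) :
    IsOpen (shrinkingIn W q) := by
  rw [isOpen_iff_mem_nhds]
  rintro f ⟨a, b, p, h, hab, hfW⟩
  have h1 := eventually_forall_mem_of_isCompact (isCompact_Icc (a := a) (b := b)) (f := f)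
    (s := {q | (q.2, orbitMeasure q.1 q.2 p) ∈ W})
    (hW.preimage (continuous_snd.prodMk (continuous_orbitMeasure p))) hfW
  filter_upwards [h.eventually, h1] with g hg1 hg2
  exact ⟨a, b, p, hg1, hab, hg2⟩

/-- A closing lemma: the nearly closed segment is moved to `n` distinct interior points, which a
small perturbation permutes cyclically while being constant around each of them. -/
theorem mem_closure_shrinkingIn {W : Set (I × ProbabilityMeasure I)} (hW : IsOpen W) {q : ℕ}
    (hq : 1 ≤ q) {f : C(I, I)}
    (h : ∀ δ > 0, ∃ (x : I) (n : ℕ+), dist (f^[n] x) x < δ ∧ (x, orbitMeasure f x n) ∈ W) :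
    f ∈ closure (shrinkingIn W q) := by
  classical
  rw [Metric.mem_closure_iff]
  intro ε hε
  obtain ⟨δ, hδ, hfδ⟩ := Metric.uniformContinuous_iff.1
    (CompactSpace.uniformContinuous_of_continuous f.continuous) (ε / 4) (by positivity)
  obtain ⟨x, n, hxn, hxW⟩ := h (ε / 8) (by positivity)
  -- A product neighbourhood of the segment on which the pair of first point and average of Dirac
  -- masses stays in `W`.
  obtain ⟨J, u, hu, hJ⟩ := isOpen_pi_iff.1
    (hW.preimage ((continuous_apply 0).prodMk (continuous_avgDirac n))) (fun j => f^[j] x) hxW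
  obtain ⟨y, hinj, hy⟩ := exists_injOn_of_infinite
    (S := fun i => ((if i ∈ J then u i else univ) ∩
      Metric.ball (f^[i] x) (min (δ / 2) (ε / 8))) ∩ Ioo 0 1)
    (fun i => infinite_inter_Ioo (c := f^[i] x) (inter_mem (by
      split_ifs with hi
      · exact (hu i hi).1.mem_nhds (hu i hi).2
      · exact univ_mem) (Metric.ball_mem_nhds _ (by positivity)))) n
  have hyW : (y 0, avgDirac n y) ∈ W := hJ fun i hi => by
    have := (hy i).1.1
    rwa [if_pos (Finset.mem_coe.1 hi)] at this
  have hyδ : ∀ i, dist (y i) (f^[i] x) < δ / 2 := fun i =>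
    (Metric.mem_ball.1 (hy i).1.2).trans_le (min_le_left _ _)
  have hyε : ∀ i, dist (y i) (f^[i] x) < ε / 8 := fun i =>
    (Metric.mem_ball.1 (hy i).1.2).trans_le (min_le_right _ _)
  have hn : 0 < (n : ℕ) := n.pos
  -- Injectivity of `y` below `n` makes the cyclic shift a well-defined map, and later gives the
  -- cycle minimal period exactly `n`.
  obtain ⟨t, ht⟩ : ∃ t : I → I, ∀ i < (n : ℕ), t (y i) = y ((i + 1) % n) :=
    ⟨fun z => y ((Function.invFunOn y (Iio (n : ℕ)) z + 1) % n), fun i hi => by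
      simp only [hinj.leftInvOn_invFunOn (show i ∈ Iio (n : ℕ) from hi)]⟩
  set F : Finset I := (Finset.range n).image y with hF
  have hmemF : ∀ i, y (i % n) ∈ F := fun i =>
    Finset.mem_image_of_mem _ (Finset.mem_range.2 (Nat.mod_lt _ hn))
  obtain ⟨ρ, hρ, hρδ, hsep⟩ := exists_pos_forall_lt_dist F (half_pos hδ)
  -- Only the last step has to jump, from near `f^[n] x` back to `y 0`; the closing error and the
  -- displacement of `y 0` cost `ε / 8` each.
  have hstep : ∀ i < (n : ℕ), dist (y ((i + 1) % n)) (f (f^[i] x)) ≤ ε / 4 := by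
    intro i hi
    rw [← Function.iterate_succ_apply' (⇑f)]
    rcases Nat.lt_or_ge (i + 1) n with h1 | h1
    · rw [Nat.mod_eq_of_lt h1]
      linarith [hyε (i + 1)]
    · have h2 : i + 1 = n := by omega
      rw [Nat.succ_eq_add_one, h2, Nat.mod_self]
      have h3 := dist_triangle (y 0) x (f^[n] x)
      have h4 := hyε 0
      rw [dist_comm] at hxn
      simp only [Function.iterate_zero, id] at h4
      linarith
  obtain ⟨g, hgf, hg⟩ := exists_perturbation f (half_lt_self hρ) (half_pos hε).le t F
    (fun y hy z hz hyz => by linarith [hsep y hy z hz hyz]) (by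
      intro w hw v hv
      obtain ⟨i, hi, rfl⟩ := Finset.mem_image.1 hw
      rw [Finset.mem_range] at hi
      rw [ht i hi]
      have h1 : dist (f (f^[i] x)) (f v) < ε / 4 := by
        apply hfδ
        have := dist_triangle v (y i) (f^[i] x)
        rw [dist_comm]
        linarith [hyδ i]
      linarith [dist_triangle (y ((i + 1) % n)) (f (f^[i] x)) (f v), hstep i hi])
  have hmodel : IsFiniteModel g F t (ρ / 2) :=
    { pos := half_pos hρ
      mapsTo := by
        intro w hw
        obtain ⟨i, hi, rfl⟩ := Finset.mem_image.1 (Finset.mem_coe.1 hw)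
        rw [ht i (Finset.mem_range.1 hi)]
        exact hmemF _
      sep := fun y hy z hz hyz => by linarith [hsep y hy z hz hyz]
      const := hg }
  have hy0 : y 0 ∈ F := by simpa using hmemF 0
  have htj : ∀ j, t^[j] (y 0) = y (j % n) := by
    intro j
    induction j with
    | zero => simp
    | succ j ih =>
      rw [Function.iterate_succ_apply', ih, ht _ (Nat.mod_lt _ hn), Nat.mod_add_mod]
  have hper : Function.IsPeriodicPt t n (y 0) := by
    change t^[n] (y 0) = y 0
    rw [htj, Nat.mod_self]
  have hmin : Function.minimalPeriod t (y 0) = n := by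
    have hpos := hper.minimalPeriod_pos hn
    refine le_antisymm (hper.minimalPeriod_le hn) (not_lt.1 fun hlt => ?_)
    have h1 := htj (Function.minimalPeriod t (y 0))
    rw [Function.iterate_minimalPeriod, Nat.mod_eq_of_lt hlt] at h1
    exact hpos.ne (hinj hn hlt h1)
  have hgW : (y 0, orbitMeasure g (y 0) n) ∈ W := by
    rw [orbitMeasure_eq_avgDirac, avgDirac_congr (w := y) fun j hj => ?_]
    · exact hyW
    · rw [hmodel.iterate_apply hy0, htj, Nat.mod_eq_of_lt hj]
  have hopen : IsOpen {z | (z, orbitMeasure g z n) ∈ W} :=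
    hW.preimage (continuous_id.prodMk
      ((continuous_orbitMeasure n).comp (continuous_const.prodMk continuous_id)))
  obtain ⟨a, b, hay, hyb, hab, hlen⟩ := exists_Icc_subset (hy 0).2
    (inter_mem (Metric.closedBall_mem_nhds (y 0) hmodel.pos) (hopen.mem_nhds hgW))
    (show (0 : ℝ) < 1 / q by positivity)
  refine ⟨g, ⟨a, b, n, ?_, hlen, fun z hz => (hab hz).2⟩, ?_⟩
  · rw [← hmin]
    exact hmodel.isPeriodicShrinking hy0 ⟨n, hn, hper⟩ hay hyb fun z hz => (hab hz).1
  · rw [dist_comm]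
    exact ((ContinuousMap.dist_le (half_pos hε).le).2 hgf).trans_lt (half_lt_self hε)

/-! ### Mean ergodic averages and recurrence -/

section MeanErgodic

variable {α : Type*} [MeasurableSpace α] {μ : Measure α} {f : α → α}

theorem birkhoffAverage_toLp (hf : MeasurePreserving f μ μ) {φ : α → ℝ} (hφ : MemLp φ 2 μ)
    (n : ℕ) : (birkhoffAverage ℝ (Lp.compMeasurePreserving f hf) id n (hφ.toLp φ) : Lp ℝ 2 μ)
      =ᵐ[μ] fun x => (n : ℝ)⁻¹ * ∑ j ∈ Finset.range n, φ (f^[j] x) := by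
  have hj : ∀ j, (Lp.compMeasurePreserving f hf)^[j] (hφ.toLp φ) =ᵐ[μ] fun x => φ (f^[j] x) := by
    intro j
    rw [Lp.compMeasurePreserving_iterate, Lp.toLp_compMeasurePreserving]
    exact MemLp.coeFn_toLp _
  rw [birkhoffAverage, birkhoffSum]
  filter_upwards [Lp.coeFn_smul ((n : ℝ)⁻¹)
      (∑ j ∈ Finset.range n, (Lp.compMeasurePreserving f hf)^[j] (hφ.toLp φ)),
    Lp.coeFn_finsetSum (Finset.range n) fun j => (Lp.compMeasurePreserving f hf)^[j] (hφ.toLp φ),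
    ae_all_iff.2 hj] with x h1 h2 h3
  simp only [id]
  rw [h1, Pi.smul_apply, h2, smul_eq_mul]
  simp [h3]

variable [IsProbabilityMeasure μ]

/-- Von Neumann's theorem: the limit is the projection onto the fixed vectors. Ergodicity makes it
constant, and pairing with the constant `1` identifies the constant as the integral. -/
theorem tendsto_birkhoffAverage_Lp_of_ergodic (h : Ergodic f μ) (u : Lp ℝ 2 μ) :
    Tendsto (birkhoffAverage ℝ (Lp.compMeasurePreserving f h.toMeasurePreserving) id · u) atTop
      (𝓝 (Lp.const 2 μ (∫ x, u x ∂μ))) := by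
  let T : Lp ℝ 2 μ →L[ℝ] Lp ℝ 2 μ :=
    (Lp.compMeasurePreservingₗᵢ ℝ f h.toMeasurePreserving).toContinuousLinearMap
  have hT := T.tendsto_birkhoffAverage_orthogonalProjection
    (LinearIsometry.norm_toContinuousLinearMap_le _) u
  set K := T.eqLocus (1 : Lp ℝ 2 μ →L[ℝ] Lp ℝ 2 μ)
  set v := K.orthogonalProjectionOnto u with hv
  have hvT : Lp.compMeasurePreserving f h.toMeasurePreserving (v : Lp ℝ 2 μ) = v := v.2
  obtain ⟨c, hc⟩ := h.eq_const_of_compMeasurePreserving_eq (congrArg Subtype.val hvT)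
  have hvc : (v : Lp ℝ 2 μ) = Lp.const 2 μ c := Subtype.ext hc
  have h1K : Lp.const 2 μ (1 : ℝ) ∈ K := by
    change Lp.compMeasurePreserving f h.toMeasurePreserving (Lp.const 2 μ (1 : ℝ)) = _
    rfl
  have hinner := Submodule.inner_orthogonalProjectionOnto_eq_of_mem_left ⟨_, h1K⟩ u
  have hone : ∀ w : Lp ℝ 2 μ, inner ℝ (Lp.const 2 μ (1 : ℝ)) w = ∫ x, w x ∂μ := by
    intro w
    rw [L2.inner_def]
    refine integral_congr_ae ?_
    filter_upwards [Lp.coeFn_const (p := 2) (μ := μ) (1 : ℝ)] with x hx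
    rw [hx]
    simp
  have hcu : c = ∫ x, u x ∂μ := by
    rw [← hone, ← hinner]
    change _ = inner ℝ (Lp.const 2 μ (1 : ℝ)) (v : Lp ℝ 2 μ)
    rw [hone, hvc, integral_congr_ae (Lp.coeFn_const (p := 2) (μ := μ) c)]
    simp
  rw [← hcu, ← hvc]
  exact hT

theorem tendstoInMeasure_average_of_ergodic (h : Ergodic f μ) {φ : α → ℝ} (hφ : MemLp φ 2 μ) :
    TendstoInMeasure μ (fun (n : ℕ) x => (n : ℝ)⁻¹ * ∑ j ∈ Finset.range n, φ (f^[j] x)) atTop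
      (fun _ => ∫ x, φ x ∂μ) := by
  have h1 := tendstoInMeasure_of_tendsto_Lp (tendsto_birkhoffAverage_Lp_of_ergodic h (hφ.toLp φ))
  refine h1.congr (fun n => birkhoffAverage_toLp h.toMeasurePreserving hφ n) ?_
  rw [integral_congr_ae hφ.coeFn_toLp]
  exact Lp.coeFn_const _ _ _

/-- The Cesàro means of these measures converge to `μ(V)²`, by pairing the mean ergodic theorem with
the indicator of `V`. -/
theorem not_tendsto_measureReal_inter_preimage (h : Ergodic f μ) {V : Set α}
    (hV : MeasurableSet V) (hμV : μ V ≠ 0) :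
    ¬ Tendsto (fun n : ℕ => μ.real (V ∩ f^[n] ⁻¹' V)) atTop (𝓝 0) := by
  intro hlim
  let u : Lp ℝ 2 μ := indicatorConstLp 2 hV (measure_ne_top μ V) (1 : ℝ)
  have h1 := (tendsto_birkhoffAverage_Lp_of_ergodic h u)
  have h2 : Tendsto (fun n : ℕ => inner ℝ u
      (birkhoffAverage ℝ (Lp.compMeasurePreserving f h.toMeasurePreserving) id n u)) atTop
      (𝓝 (inner ℝ u (Lp.const 2 μ (∫ x, u x ∂μ)))) := tendsto_const_nhds.inner h1
  have h3 : ∀ n : ℕ, inner ℝ u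
      (birkhoffAverage ℝ (Lp.compMeasurePreserving f h.toMeasurePreserving) id n u) =
      (n : ℝ)⁻¹ * ∑ j ∈ Finset.range n, μ.real (V ∩ f^[j] ⁻¹' V) := by
    intro n
    rw [birkhoffAverage, birkhoffSum, inner_smul_right, inner_sum]
    congr 1
    refine Finset.sum_congr rfl fun j _ => ?_
    rw [Lp.compMeasurePreserving_iterate, id, Lp.indicatorConstLp_compMeasurePreserving,
      L2.real_inner_indicatorConstLp_one_indicatorConstLp_one]
  simp only [h3] at h2
  have h4 := tendsto_nhds_unique h2 hlim.cesaro
  have h5 : ∫ x, u x ∂μ = μ.real V := by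
    rw [integral_indicatorConstLp]
    simp
  have h6 : inner ℝ u (Lp.const 2 μ (∫ x, u x ∂μ)) = μ.real V * μ.real V := by
    rw [h5, L2.inner_indicatorConstLp_one, setIntegral_congr_ae hV
      (g := fun _ => μ.real V)
      ((Lp.coeFn_const (p := 2) (μ := μ) (μ.real V)).mono fun x hx _ => hx)]
    simp
  rw [h6] at h4
  have : μ.real V ≠ 0 := by simpa [measureReal_def, ENNReal.toReal_eq_zero_iff] using hμV
  exact this (mul_self_eq_zero.1 h4)

end MeanErgodic

/-- An ergodic measure is approached by orbit segments which nearly close up. -/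
theorem exists_dist_iterate_lt_and_measureDist_lt (Ψ : ℕ → C(I, I)) {f : C(I, I)}
    {μ : ProbabilityMeasure I} (h : Ergodic f (μ : Measure I)) :
    ∃ c : I, ∀ ε > 0, ∃ (x : I) (n : ℕ+), dist x c < ε ∧ dist (f^[n] x) x < ε ∧
      measureDist Ψ (orbitMeasure f x n) μ < ε := by
  -- A point of the support of `μ`.
  obtain ⟨c, -, hcn⟩ := exists_mem_forall_mem_nhdsWithin_pos_measure
    (μ := (μ : Measure I)) (s := univ) (by simp)
  refine ⟨c, fun δ hδ => ?_⟩
  obtain ⟨m, η, hη, hm⟩ := exists_forall_measureDist_lt Ψ hδ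
  have hc : (μ : Measure I) (Metric.ball c (δ / 2)) ≠ 0 :=
    (hcn _ (mem_nhdsWithin_of_mem_nhds (Metric.ball_mem_nhds c (half_pos hδ)))).ne'
  set V := Metric.ball c (δ / 2)
  have hV : MeasurableSet V := Metric.isOpen_ball.measurableSet
  by_contra! hcon
  -- If no segment worked, every point of `V` returning to `V` at time `n` would have, for some `i <
  -- m`, an average of `Ψ i` at least `η` away from its integral. Convergence in measure makes this
  -- set negligible, contradicting recurrence.
  apply not_tendsto_measureReal_inter_preimage h hV hc
  let A : ℕ → ℕ → I → ℝ := fun i n x => (n : ℝ)⁻¹ * ∑ j ∈ Finset.range n, (Ψ i (f^[j] x) : ℝ)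
  have hA : ∀ i, Tendsto (fun n => (μ : Measure I)
      {x | ENNReal.ofReal η ≤ edist (A i n x) (∫ x, (Ψ i x : ℝ) ∂(μ : Measure I))})
      atTop (𝓝 0) := by
    intro i
    have hmem : MemLp (fun x => (Ψ i x : ℝ)) 2 (μ : Measure I) :=
      MemLp.of_bound (continuous_subtype_val.comp (Ψ i).continuous).aestronglyMeasurable 1
        (Eventually.of_forall fun x => by
          rw [Real.norm_of_nonneg (Ψ i x).2.1]
          exact (Ψ i x).2.2)
    exact tendstoInMeasure_average_of_ergodic h hmem _ (ENNReal.ofReal_pos.2 hη)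
  have hsum := tendsto_finsetSum (Finset.range m) fun i _ => hA i
  rw [Finset.sum_const_zero] at hsum
  have hreal := (ENNReal.tendsto_toReal ENNReal.zero_ne_top).comp hsum
  rw [ENNReal.toReal_zero] at hreal
  refine squeeze_zero' (Eventually.of_forall fun _ => measureReal_nonneg) ?_ hreal
  filter_upwards [eventually_ge_atTop 1] with n hn
  refine ENNReal.toReal_mono ?_ ?_
  · exact (ENNReal.sum_lt_top.2 fun i _ => measure_lt_top _ _).ne
  · refine (measure_mono ?_).trans (measure_biUnion_finset_le (Finset.range m) fun i =>
      {x | ENNReal.ofReal η ≤ edist (A i n x) (∫ x, (Ψ i x : ℝ) ∂(μ : Measure I))})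
    rintro x ⟨hx1, hx2⟩
    by_contra hx
    simp only [mem_iUnion, Finset.mem_range, not_exists] at hx
    have hdist : dist (f^[(⟨n, hn⟩ : ℕ+)] x) x < δ := by
      have h1 := dist_triangle_right (f^[n] x) x c
      have h2 : dist (f^[n] x) c < δ / 2 := hx2
      have h3 : dist x c < δ / 2 := hx1
      change dist (f^[n] x) x < δ
      linarith
    have hxc : dist x c < δ := (Metric.mem_ball.1 hx1).trans (half_lt_self hδ)
    refine absurd (hcon x ⟨n, hn⟩ hxc hdist) (not_le.2 (hm _ _ fun i hi => ?_))
    have h1 := hx i hi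
    replace h1 : edist (A i n x) (∫ x, (Ψ i x : ℝ) ∂(μ : Measure I)) < ENNReal.ofReal η :=
      not_le.1 h1
    rw [edist_lt_ofReal, Real.dist_eq] at h1
    rw [integral_orbitMeasure f x ⟨n, hn⟩ (fun y => (Ψ i y : ℝ))]
    exact h1.le

/-! ### Almost every point enters short periodic shrinking intervals -/

/-- The points whose orbit enters a periodic shrinking interval of length less than `1/q`. -/
def capturedSet (f : C(I, I)) (q : ℕ) : Set I :=
  {x | ∃ (n : ℕ) (a b : I) (p : ℕ), IsPeriodicShrinking f a b p ∧ (b : ℝ) - a < 1 / q ∧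
    f^[n] x ∈ Ioo a b}

theorem isOpen_capturedSet (f : C(I, I)) (q : ℕ) : IsOpen (capturedSet f q) := by
  rw [isOpen_iff_mem_nhds]
  rintro x ⟨n, a, b, p, h, hab, hx⟩
  filter_upwards [(isOpen_Ioo.preimage (f.continuous.iterate n)).mem_nhds hx] with y hy
  exact ⟨n, a, b, p, h, hab, hy⟩

/-- A stably large set of points is captured. -/
def stablyCapturing (q : ℕ) (κ : ℝ) : Set C(I, I) :=
  interior {f | ENNReal.ofReal (1 - κ) ≤ (volume : Measure I) (capturedSet f q)}

/-- Pigeonhole. The bound `1 ≤ n` matters because points of the ball around `y` follow the orbit of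
`y` only from the first iterate on. -/
theorem exists_iterate_mem_periodicPts {F : Finset I} {t : I → I} (ht : MapsTo t F F) {y : I}
    (hy : y ∈ F) : ∃ n, 1 ≤ n ∧ t^[n] y ∈ F ∧ t^[n] y ∈ Function.periodicPts t := by
  have hmaps : ∀ n, t^[n + 1] y ∈ (F : Set I) := fun n => ht.iterate (n + 1) hy
  obtain ⟨i, j, hij, heq⟩ := F.finite_toSet.exists_lt_map_eq_of_forall_mem hmaps
  refine ⟨i + 1, by omega, hmaps i, j - i, by omega, ?_⟩
  change t^[j - i] (t^[i + 1] y) = _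
  rw [← Function.iterate_add_apply, show j - i + (i + 1) = j + 1 by omega]
  exact heq.symm

/-- Under `g` each ball falls into a cycle of `t`, each point of which has its own shrinking
interval. The finitely many intervals persist for nearby maps, and so does entry into them from the
compact union of balls. -/
theorem IsFiniteModel.eventually_subset_capturedSet {g : C(I, I)} {F : Finset I} {t : I → I}
    {r : ℝ} (h : IsFiniteModel g F t r) (hF : ∀ y ∈ F, y ∈ Ioo (0 : I) 1) {q : ℕ} (hq : 1 ≤ q) :
    ∀ᶠ f in 𝓝 g, ⋃ y ∈ F, Metric.closedBall y r ⊆ capturedSet f q := by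
  have hex : ∀ y ∈ F, ∃ a b, a < y ∧ y < b ∧ Icc a b ⊆ Metric.closedBall y r ∧
      (b : ℝ) - a < 1 / q := fun y hy =>
    exists_Icc_subset (hF y hy) (Metric.closedBall_mem_nhds y h.pos) (by positivity)
  choose! a b hay hyb hab hlen using hex
  have h1 : ∀ᶠ f in 𝓝 g, ∀ y ∈ F, y ∈ Function.periodicPts t →
      IsPeriodicShrinking f (a y) (b y) (Function.minimalPeriod t y) := by
    simp only [Filter.eventually_all_finset, Filter.eventually_imp_distrib_left]
    intro y hy hper
    exact (h.isPeriodicShrinking hy hper (hay y hy) (hyb y hy) (hab y hy)).eventually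
  have hR : IsCompact (⋃ y ∈ F, Metric.closedBall y r) :=
    F.isCompact_biUnion fun y _ => isCompact_closedBall y r
  have hopen : IsOpen {w : C(I, I) × I | ∃ n : ℕ, ∃ y ∈ F, y ∈ Function.periodicPts t ∧
      w.1^[n] w.2 ∈ Ioo (a y) (b y)} := by
    have : {w : C(I, I) × I | ∃ n : ℕ, ∃ y ∈ F, y ∈ Function.periodicPts t ∧
        w.1^[n] w.2 ∈ Ioo (a y) (b y)} = ⋃ n : ℕ, ⋃ y ∈ F, ⋃ _ : y ∈ Function.periodicPts t,
          (fun w : C(I, I) × I => w.1^[n] w.2) ⁻¹' Ioo (a y) (b y) := by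
      ext w
      simp only [mem_iUnion, mem_preimage, exists_prop, mem_ofPred_eq]
    rw [this]
    exact isOpen_iUnion fun n => isOpen_biUnion fun y _ => isOpen_iUnion fun _ =>
      isOpen_Ioo.preimage (continuous_iterate_apply n)
  have h2 := eventually_forall_mem_of_isCompact hR hopen (f := g) (by
    intro x hx
    simp only [mem_iUnion] at hx
    obtain ⟨y, hy, hxy⟩ := hx
    obtain ⟨n, hn, hnF, hper⟩ := exists_iterate_mem_periodicPts h.mapsTo hy
    refine ⟨n, t^[n] y, hnF, hper, ?_⟩
    change g^[n] x ∈ _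
    rw [h.iterate_apply_of_dist_le hy hxy hn]
    exact ⟨hay _ hnF, hyb _ hnF⟩)
  filter_upwards [h1, h2] with f h1 h2 x hx
  obtain ⟨n, y, hy, hper, hn⟩ := h2 x hx
  exact ⟨n, a y, b y, _, h1 y hy hper, hlen y hy, hn⟩

/-! ### The uniform grid and density of capturing maps -/

/-- The centre of the `i`-th of the `N` intervals of equal length dividing `[0, 1]`. -/
noncomputable def gridPoint (N i : ℕ) : I := projIcc 0 1 zero_le_one ((2 * i + 1) / (2 * N) : ℝ)

theorem coe_gridPoint {N i : ℕ} (hi : i < N) : (gridPoint N i : ℝ) = (2 * i + 1) / (2 * N) := by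
  have hN : (0 : ℝ) < N := by exact_mod_cast (Nat.zero_le i).trans_lt hi
  have hiN : (i : ℝ) + 1 ≤ N := by exact_mod_cast hi
  rw [gridPoint, projIcc_of_mem]
  exact ⟨by positivity, by rw [div_le_one (by positivity)]; linarith⟩

theorem gridPoint_mem_Ioo {N i : ℕ} (hi : i < N) : gridPoint N i ∈ Ioo (0 : I) 1 := by
  have hN : (0 : ℝ) < N := by exact_mod_cast (Nat.zero_le i).trans_lt hi
  have hiN : (i : ℝ) + 1 ≤ N := by exact_mod_cast hi
  refine ⟨Subtype.coe_lt_coe.1 ?_, Subtype.coe_lt_coe.1 ?_⟩ <;> rw [coe_gridPoint hi]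
  · exact div_pos (by positivity) (by positivity)
  · change _ < (1 : ℝ)
    rw [div_lt_one (by positivity)]
    linarith

theorem one_div_le_dist_gridPoint {N i j : ℕ} (hi : i < N) (hj : j < N) (hij : i ≠ j) :
    1 / (N : ℝ) ≤ dist (gridPoint N i) (gridPoint N j) := by
  have hN : (0 : ℝ) < N := by exact_mod_cast (Nat.zero_le i).trans_lt hi
  rw [Subtype.dist_eq, coe_gridPoint hi, coe_gridPoint hj, Real.dist_eq,
    show ((2 * i + 1) / (2 * N) - (2 * j + 1) / (2 * N) : ℝ) = (i - j) / N by field_simp; ring,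
    abs_div, abs_of_pos hN]
  gcongr
  have : (1 : ℤ) ≤ |(i : ℤ) - j| := Int.one_le_abs (by omega)
  exact_mod_cast this

theorem exists_dist_gridPoint_le {N : ℕ} (hN : 1 ≤ N) (w : I) :
    ∃ i < N, dist (gridPoint N i) w ≤ 1 / (2 * N) := by
  have hN0 : (0 : ℝ) < N := by exact_mod_cast hN
  have hw0 : (0 : ℝ) ≤ w := w.2.1
  have hw1 : (w : ℝ) ≤ 1 := w.2.2
  -- At `w = 1` the floor of `w * N` would be the excluded index `N`.
  rcases eq_or_lt_of_le hw1 with h1 | h1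
  · have hi : N - 1 < N := by omega
    refine ⟨N - 1, hi, ?_⟩
    rw [Subtype.dist_eq, coe_gridPoint hi, h1, Real.dist_eq, Nat.cast_sub hN,
      show ((2 * ((N : ℝ) - (1 : ℕ)) + 1) / (2 * N) - 1 : ℝ) = -(1 / (2 * N)) by
        push_cast; field_simp; ring, abs_neg, abs_of_pos (by positivity)]
  · have hfl := Nat.floor_le (show (0 : ℝ) ≤ w * N by positivity)
    have hlt := Nat.lt_floor_add_one ((w : ℝ) * N)
    have hi : ⌊(w : ℝ) * N⌋₊ < N := by
      rw [Nat.floor_lt (by positivity)]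
      nlinarith
    refine ⟨⌊(w : ℝ) * N⌋₊, hi, ?_⟩
    rw [Subtype.dist_eq, coe_gridPoint hi, Real.dist_eq,
      show ((2 * (⌊(w : ℝ) * N⌋₊ : ℝ) + 1) / (2 * N) - w : ℝ) =
        (2 * ((⌊(w : ℝ) * N⌋₊ : ℝ) - w * N) + 1) / (2 * N) by field_simp; ring,
      abs_div, abs_of_pos (show (0 : ℝ) < 2 * N by positivity)]
    gcongr
    rw [abs_le]
    constructor <;> linarith

theorem ofReal_le_volume_iUnion_closedBall_gridPoint {N : ℕ} (hN : 1 ≤ N) {κ : ℝ} (hκ : 0 < κ)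
    (hκ1 : κ < 1) :
    ENNReal.ofReal (1 - κ) ≤ (volume : Measure I)
      (⋃ i ∈ Finset.range N, Metric.closedBall (gridPoint N i) ((1 - κ) / (2 * N))) := by
  have hN0 : (0 : ℝ) < N := by exact_mod_cast hN
  rw [measure_biUnion_finset]
  · have hball : ∀ i ∈ Finset.range N, ENNReal.ofReal ((1 - κ) / N) ≤
        (volume : Measure I) (Metric.closedBall (gridPoint N i) ((1 - κ) / (2 * N))) := by
      intro i hi
      rw [Finset.mem_range] at hi
      have hiN : (i : ℝ) + 1 ≤ N := by exact_mod_cast hi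
      have hi0 : (0 : ℝ) ≤ i := by positivity
      have hl : (2 * i + 1) / (2 * N) - (1 - κ) / (2 * N) ∈ Icc (0 : ℝ) 1 := by
        rw [← sub_div]
        exact ⟨div_nonneg (by linarith) (by positivity),
          (div_le_one (by positivity)).2 (by linarith)⟩
      have hu : (2 * i + 1) / (2 * N) + (1 - κ) / (2 * N) ∈ Icc (0 : ℝ) 1 := by
        rw [← add_div]
        exact ⟨div_nonneg (by linarith) (by positivity),
          (div_le_one (by positivity)).2 (by linarith)⟩
      have hsub : Icc (⟨_, hl⟩ : I) ⟨_, hu⟩ ⊆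
          Metric.closedBall (gridPoint N i) ((1 - κ) / (2 * N)) := by
        intro x hx
        have h1 : (2 * i + 1) / (2 * N) - (1 - κ) / (2 * N) ≤ (x : ℝ) := hx.1
        have h2 : (x : ℝ) ≤ (2 * i + 1) / (2 * N) + (1 - κ) / (2 * N) := hx.2
        rw [Metric.mem_closedBall, Subtype.dist_eq, coe_gridPoint hi, Real.dist_eq, abs_le]
        constructor <;> linarith
      refine le_trans (le_of_eq ?_) (measure_mono hsub)
      rw [unitInterval.volume_Icc]
      congr 1
      change (1 - κ) / N = (2 * i + 1) / (2 * N) + (1 - κ) / (2 * N) -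
        ((2 * i + 1) / (2 * N) - (1 - κ) / (2 * N))
      field_simp
      ring
    refine le_trans (le_of_eq ?_) (Finset.sum_le_sum hball)
    rw [Finset.sum_const, Finset.card_range, nsmul_eq_mul, ← ENNReal.ofReal_natCast,
      ← ENNReal.ofReal_mul (by positivity)]
    congr 1
    field_simp
  · intro i hi j hj hij
    refine Metric.closedBall_disjoint_closedBall (lt_of_lt_of_le ?_ (one_div_le_dist_gridPoint
      (Finset.mem_range.1 hi) (Finset.mem_range.1 hj) hij))
    rw [show (1 - κ) / (2 * N) + (1 - κ) / (2 * N) = (1 - κ) / N by field_simp; ring]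
    gcongr
    linarith
  · exact fun i _ => Metric.isClosed_closedBall.measurableSet

/-- The values of `f` at the grid points are rounded to the grid and made constant on balls filling
a proportion `1 - κ` of the cells; the remaining gaps leave room to interpolate. -/
theorem dense_stablyCapturing {q : ℕ} (hq : 1 ≤ q) {κ : ℝ} (hκ : 0 < κ) (hκ1 : κ < 1) :
    Dense (stablyCapturing q κ) := by
  classical
  intro f
  rw [Metric.mem_closure_iff]
  intro ε hε
  obtain ⟨δ, hδ, hfδ⟩ := Metric.uniformContinuous_iff.1
    (CompactSpace.uniformContinuous_of_continuous f.continuous) (ε / 4) (by positivity)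
  obtain ⟨N, hNδ, hN⟩ := ((tendsto_one_div_atTop_nhds_zero_nat.eventually
    (gt_mem_nhds (show (0 : ℝ) < min δ (ε / 4) by positivity))).and (eventually_ge_atTop 1)).exists
  have hN0 : (0 : ℝ) < N := by exact_mod_cast hN
  have hhalf : 1 / (2 * N : ℝ) < 1 / N := by gcongr; linarith
  have hhalf2 : 1 / (N : ℝ) = 1 / (2 * N) + 1 / (2 * N) := by field_simp; ring
  have hκN : (1 - κ) / (2 * N) < 1 / (2 * N) := by gcongr; linarith
  choose τ hτN hτ using exists_dist_gridPoint_le hN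
  let F : Finset I := (Finset.range N).image (gridPoint N)
  let t : I → I := fun y => gridPoint N (τ (f y))
  have hsep : ∀ y ∈ F, ∀ z ∈ F, y ≠ z → 1 / (N : ℝ) ≤ dist y z := by
    intro y hy z hz hyz
    obtain ⟨i, hi, rfl⟩ := Finset.mem_image.1 hy
    obtain ⟨j, hj, rfl⟩ := Finset.mem_image.1 hz
    exact one_div_le_dist_gridPoint (Finset.mem_range.1 hi) (Finset.mem_range.1 hj)
      fun hij => hyz (by rw [hij])
  obtain ⟨g, hgf, hg⟩ := exists_perturbation f hκN (half_pos hε).le t F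
    (fun y hy z hz hyz => by linarith [hsep y hy z hz hyz]) (by
      intro y _ x hx
      have h1 := hfδ (hx.trans_lt (hhalf.trans (hNδ.trans_le (min_le_left _ _))))
      have h2 := dist_triangle_right (t y) (f x) (f y)
      have h3 := hτ (f y)
      have h4 := hNδ.trans_le (min_le_right _ _)
      linarith)
  have hmodel : IsFiniteModel g F t ((1 - κ) / (2 * N)) :=
    { pos := div_pos (by linarith) (by positivity)
      mapsTo := fun y _ => Finset.mem_coe.2
        (Finset.mem_image_of_mem _ (Finset.mem_range.2 (hτN _)))
      sep := fun y hy z hz hyz => by linarith [hsep y hy z hz hyz]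
      const := hg }
  refine ⟨g, ?_, ?_⟩
  · rw [stablyCapturing, mem_interior_iff_mem_nhds]
    filter_upwards [hmodel.eventually_subset_capturedSet (by
      intro y hy
      obtain ⟨i, hi, rfl⟩ := Finset.mem_image.1 hy
      exact gridPoint_mem_Ioo (Finset.mem_range.1 hi)) hq] with g' hg'
    refine (ofReal_le_volume_iUnion_closedBall_gridPoint hN hκ hκ1).trans (measure_mono ?_)
    refine Subset.trans ?_ hg'
    exact iUnion₂_subset fun i hi =>
      subset_biUnion_of_mem (u := fun y => Metric.closedBall y ((1 - κ) / (2 * N)))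
        (Finset.mem_coe.2 (Finset.mem_image_of_mem (gridPoint N) hi))
  · rw [dist_comm]
    exact ((ContinuousMap.dist_le (half_pos hε).le).2 hgf).trans_lt (half_lt_self hε)

theorem ae_mem_capturedSet {f : C(I, I)} {q : ℕ}
    (h : ∀ k : ℕ, f ∈ stablyCapturing q (1 / (k + 2))) :
    ∀ᵐ x ∂(volume : Measure I), x ∈ capturedSet f q := by
  change (volume : Measure I) (capturedSet f q)ᶜ = 0
  rw [prob_compl_eq_zero_iff (isOpen_capturedSet f q).measurableSet]
  have hk : ∀ k : ℕ, ENNReal.ofReal (1 - 1 / ((k : ℝ) + 2)) ≤ volume (capturedSet f q) := fun k =>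
    (interior_subset (h k) :
      f ∈ {f | ENNReal.ofReal (1 - 1 / ((k : ℝ) + 2)) ≤ volume (capturedSet f q)})
  have h1 : Tendsto (fun k : ℕ => 1 - 1 / ((k : ℝ) + 2)) atTop (𝓝 (1 - 0)) :=
    tendsto_const_nhds.sub (tendsto_const_nhds.div_atTop
      (tendsto_natCast_atTop_atTop.atTop_add tendsto_const_nhds))
  rw [sub_zero] at h1
  have h2 := ENNReal.tendsto_ofReal h1
  rw [ENNReal.ofReal_one] at h2
  exact le_antisymm prob_le_one (le_of_tendsto' h2 hk)

/-! ### Typical maps -/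

instance secondCountableTopology_probabilityMeasure :
    SecondCountableTopology (ProbabilityMeasure I) :=
  letI := TopologicalSpace.metrizableSpaceMetric (ProbabilityMeasure I)
  inferInstance

/-- The pair `(c, μ)` is a limit of pairs formed by a point and its orbit measure, along orbit
segments which close up in the limit. -/
def IsClosable (f : C(I, I)) (w : I × ProbabilityMeasure I) : Prop :=
  ∀ W ∈ 𝓝 w, ∀ δ > 0, ∃ (x : I) (n : ℕ+), dist (f^[n] x) x < δ ∧ (x, orbitMeasure f x n) ∈ W

theorem isClosable_of_iterate_eq {f : C(I, I)} {x : I} {n : ℕ+} (h : f^[n] x = x) :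
    IsClosable f (x, orbitMeasure f x n) := fun _ hW δ hδ =>
  ⟨x, n, by rwa [h, dist_self], mem_of_mem_nhds hW⟩

theorem exists_isClosable_of_ergodic {Ψ : ℕ → C(I, I)} (hΨ : DenseRange Ψ) {f : C(I, I)}
    {μ : ProbabilityMeasure I} (h : Ergodic f (μ : Measure I)) : ∃ c, IsClosable f (c, μ) := by
  obtain ⟨c, hc⟩ := exists_dist_iterate_lt_and_measureDist_lt Ψ h
  refine ⟨c, fun W hW δ hδ => ?_⟩
  choose x n hxc hxn hμ using fun k : ℕ => hc (1 / (k + 1)) (by positivity)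
  have h0 := tendsto_one_div_add_atTop_nhds_zero_nat (𝕜 := ℝ)
  have h1 : Tendsto x atTop (𝓝 c) := by
    rw [tendsto_iff_dist_tendsto_zero]
    exact squeeze_zero (fun _ => dist_nonneg) (fun k => (hxc k).le) h0
  have h2 : Tendsto (fun k => orbitMeasure f (x k) (n k)) atTop (𝓝 μ) :=
    tendsto_of_tendsto_measureDist hΨ (squeeze_zero (fun _ => measureDist_nonneg _ _ _)
      (fun k => (measureDist_comm Ψ _ _).trans_le (hμ k).le) h0)
  obtain ⟨k, hk1, hk2⟩ :=
    (((h1.prodMk_nhds h2).eventually hW).and (h0.eventually (gt_mem_nhds hδ))).exists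
  exact ⟨x k, n k, (hxn k).trans hk2, hk1⟩

/-- The properties of a typical map from which the theorem is derived: closable pairs are
approached by short periodic shrinking intervals, and almost every point enters such intervals. -/
structure IsTypical (f : C(I, I)) : Prop where
  mem_shrinkingIn : ∀ w, IsClosable f w → ∀ W ∈ 𝓝 w, ∀ q : ℕ, 1 ≤ q → f ∈ shrinkingIn W q
  ae_mem_capturedSet : ∀ᵐ x ∂(volume : Measure I), ∀ q : ℕ, 1 ≤ q → x ∈ capturedSet f q

/-- For open `A` this is a dense open set on which lying in the closure of `A` forces lying in `A`.
It turns approximability into membership for typical maps. -/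
theorem dense_union_compl_closure {X : Type*} [TopologicalSpace X] (A : Set X) :
    Dense (A ∪ (closure A)ᶜ) := by
  intro x
  by_cases hx : x ∈ closure A
  · exact closure_mono subset_union_left hx
  · exact subset_closure (Or.inr hx)

/-- A countable basis of pairs (point, measure) reduces the first property to countably many dense
open conditions; the second needs only countably many `q` and `κ`. -/
theorem exists_isGδ_dense_isTypical :
    ∃ G : Set C(I, I), IsGδ G ∧ Dense G ∧ ∀ f ∈ G, IsTypical f := by
  let B := TopologicalSpace.countableBasis (I × ProbabilityMeasure I)
  have hB : TopologicalSpace.IsTopologicalBasis B := TopologicalSpace.isBasis_countableBasis _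
  have : Countable B := (TopologicalSpace.countable_countableBasis _).to_subtype
  let S : B × ℕ → Set C(I, I) := fun w => shrinkingIn w.1 (w.2 + 1)
  have hS : ∀ w, IsOpen (S w) := fun w => isOpen_shrinkingIn (hB.isOpen w.1.2) _
  let U : B × ℕ → Set C(I, I) := fun w => S w ∪ (closure (S w))ᶜ
  let C : ℕ × ℕ → Set C(I, I) := fun w => stablyCapturing (w.1 + 1) (1 / (w.2 + 2))
  have hU : ∀ w, IsOpen (U w) := fun w => (hS w).union isClosed_closure.isOpen_compl
  have hC : ∀ w, IsOpen (C w) := fun w => isOpen_interior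
  have hCd : ∀ w, Dense (C w) := fun w => dense_stablyCapturing (by omega) (by positivity) (by
    rw [div_lt_one (by positivity)]
    have : (0 : ℝ) ≤ w.2 := by positivity
    linarith)
  refine ⟨(⋂ w, U w) ∩ ⋂ w, C w,
    (IsGδ.iInter_of_isOpen hU).inter (IsGδ.iInter_of_isOpen hC),
    (dense_iInter_of_isOpen hU fun w => dense_union_compl_closure _).inter_of_Gδ
      (IsGδ.iInter_of_isOpen hU) (IsGδ.iInter_of_isOpen hC) (dense_iInter_of_isOpen hC hCd), ?_⟩
  rintro f ⟨hfU, hfC⟩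
  rw [mem_iInter] at hfU hfC
  refine ⟨fun w hw W hW q hq => ?_, ?_⟩
  · obtain ⟨V, hVB, hwV, hVW⟩ := hB.mem_nhds_iff.1 hW
    obtain ⟨q, rfl⟩ := Nat.exists_eq_add_of_le' hq
    have hcl : f ∈ closure (S (⟨V, hVB⟩, q)) :=
      mem_closure_shrinkingIn (hB.isOpen hVB) hq (hw V ((hB.isOpen hVB).mem_nhds hwV))
    rcases hfU (⟨V, hVB⟩, q) with h | h
    · obtain ⟨a, b, p, h1, h2, h3⟩ := h
      exact ⟨a, b, p, h1, h2, fun x hx => hVW (h3 x hx)⟩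
    · exact absurd hcl h
  · have := ae_all_iff.2 fun q : ℕ => ae_mem_capturedSet fun k => hfC (q, k)
    filter_upwards [this] with x hx q hq
    obtain ⟨q, rfl⟩ := Nat.exists_eq_add_of_le' hq
    exact hx q

/-! ### Invariant measures of typical maps -/

/-- A strictly invariant set, or its complement, contains `x` and hence the whole orbit carrying the
measure. -/
theorem periodicMeasures_subset_ergodicMeasures (f : C(I, I)) :
    periodicMeasures f ⊆ ergodicMeasures f := by
  rintro μ ⟨x, r, hr, rfl⟩
  have hfix : f^[r] x = x := by
    rw [← hr]
    exact Function.iterate_minimalPeriod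
  have hinv : MeasurePreserving f (orbitMeasure f x r : Measure I) (orbitMeasure f x r) :=
    orbitMeasure_mem_invariantMeasures hfix
  refine { hinv with aeconst_set := fun s hs hfs => ?_ }
  have key : ∀ s : Set I, MeasurableSet s → f ⁻¹' s = s → x ∈ s →
      ∀ᵐ y ∂(orbitMeasure f x r : Measure I), y ∈ s := by
    intro s hs hfs hxs
    have hmaps : MapsTo f s s := fun y hy => by rwa [← mem_preimage, hfs]
    change (orbitMeasure f x r : Measure I) sᶜ = 0
    rw [prob_compl_eq_zero_iff hs]
    exact avgDirac_apply_eq_one hs fun j _ => hmaps.iterate j hxs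
  rw [eventuallyConst_set]
  by_cases hxs : x ∈ s
  · exact Or.inl (key s hs hfs hxs)
  · exact Or.inr (key sᶜ hs.compl (by rw [preimage_compl, hfs]) hxs)

theorem periodicMeasures_subset_invariantMeasures (f : C(I, I)) :
    periodicMeasures f ⊆ invariantMeasures f := fun _ hμ =>
  (periodicMeasures_subset_ergodicMeasures f hμ).toMeasurePreserving

theorem shrinkedPeriodic_subset_approxShrinkedPeriodic (Ψ : ℕ → C(I, I)) (f : C(I, I)) {ε : ℝ}
    (hε : 0 < ε) (q : ℕ) : shrinkedPeriodic f q ⊆ approxShrinkedPeriodic Ψ f ε q := fun μ hμ =>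
  ⟨periodicMeasures_subset_invariantMeasures f hμ.1, μ, hμ, by rwa [measureDist_self]⟩

theorem exists_isClosable_of_mem_periodicMeasures {f : C(I, I)} {μ : ProbabilityMeasure I}
    (h : μ ∈ periodicMeasures f) : ∃ c, IsClosable f (c, μ) := by
  obtain ⟨x, r, hr, rfl⟩ := h
  refine ⟨x, isClosable_of_iterate_eq ?_⟩
  rw [← hr]
  exact Function.iterate_minimalPeriod

theorem IsPeriodicShrinking.exists_mem_periodicMeasures {f : C(I, I)} {a b : I} {p : ℕ+}
    (h : IsPeriodicShrinking f a b p) :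
    ∃ z ∈ Ioo a b, f^[p] z = z ∧ orbitMeasure f z p ∈ periodicMeasures f ∧
      (orbitMeasure f z p : Measure I) (orbitSet f a b p) = 1 := by
  obtain ⟨z, hz, hmin⟩ := h.exists_minimalPeriod_eq
  have hfix : f^[p] z = z := by
    rw [← hmin]
    exact Function.iterate_minimalPeriod
  exact ⟨z, hz, hfix, ⟨z, p, hmin, rfl⟩,
    h.orbitMeasure_orbitSet (Ioo_subset_Icc_self hz) p hfix⟩

theorem IsPeriodicShrinking.orbitSet_subset {f : C(I, I)} {a b a' b' : I} {p : ℕ}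
    (h : IsPeriodicShrinking f a b p) (hsub : Icc a' b' ⊆ Icc a b) (p' : ℕ) :
    orbitSet f a' b' p' ⊆ orbitSet f a b p := by
  intro x hx
  simp only [orbitSet, Finset.mem_Icc, mem_iUnion] at hx
  obtain ⟨j, hj, y, hy, rfl⟩ := hx
  exact h.iterate_mem_orbitSet (hsub hy) hj.1

theorem IsPeriodicShrinking.pomega_orbitSet {f : C(I, I)} {a b : I} {p : ℕ}
    (h : IsPeriodicShrinking f a b p) {x : I} {n : ℕ}
    (hx : f^[n] x ∈ Icc a b) {ν : ProbabilityMeasure I} (hν : ν ∈ pomega f x) :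
    (ν : Measure I) (orbitSet f a b p) = 1 := by
  refine pomega_apply_eq_one (isClosed_orbitSet f a b p) (m := n + 1) (fun j hj => ?_) hν
  have : f^[j] x = f^[j - n] (f^[n] x) := by
    rw [← Function.iterate_add_apply, Nat.sub_add_cancel (by omega)]
  rw [this]
  exact h.iterate_mem_orbitSet hx (by omega)

theorem shrinkedMeasures_subset_closure_periodicMeasures {Ψ : ℕ → C(I, I)} (hΨ : DenseRange Ψ)
    (f : C(I, I)) : shrinkedMeasures f ⊆ closure (periodicMeasures f) := by
  rintro μ ⟨hμ, hq⟩
  refine mem_closure_of_measureDist hΨ fun ε hε => ?_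
  obtain ⟨q, hq1, hdist⟩ := exists_forall_isPeriodicShrinking_measureDist_lt Ψ hε
  obtain ⟨a, b, p, hs, hlen, hone⟩ := hq q hq1
  lift p to ℕ+ using hs.one_le
  obtain ⟨z, hz, -, hper, -⟩ := hs.exists_mem_periodicMeasures
  exact ⟨_, hper, hdist f a b p hs hlen z (Ioo_subset_Icc_self hz) μ hμ hone⟩

theorem isClosed_pseudoPhysical (Ψ : ℕ → C(I, I)) (f : C(I, I)) :
    IsClosed (pseudoPhysical Ψ f) := by
  refine isClosed_of_closure_subset fun μ hμ ε hε => ?_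
  obtain ⟨ν, hν, hνμ⟩ := exists_measureDist_lt_of_mem_closure Ψ hμ (half_pos hε)
  refine (hν (ε / 2) (half_pos hε)).trans_le (measure_mono ?_)
  rintro x ⟨ρ, hρ, hρν⟩
  exact ⟨ρ, hρ, by linarith [measureDist_triangle Ψ ρ ν μ]⟩

namespace IsTypical

variable {f : C(I, I)}

theorem mem_closure_shrinkedPeriodic (hf : IsTypical f) {c : I} {μ : ProbabilityMeasure I}
    (h : IsClosable f (c, μ)) {q : ℕ} (hq : 1 ≤ q) : μ ∈ closure (shrinkedPeriodic f q) := by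
  rw [mem_closure_iff]
  intro U hU hμU
  obtain ⟨a, b, p, hs, hlen, hW⟩ := hf.mem_shrinkingIn _ h (Prod.snd ⁻¹' U)
    ((hU.preimage continuous_snd).mem_nhds hμU) q hq
  obtain ⟨z, hz, -, hper, hone⟩ := hs.exists_mem_periodicMeasures
  exact ⟨_, hW z (Ioo_subset_Icc_self hz), hper, a, b, p, hs, hlen, hone⟩

/-- Near a closable pair there is a short periodic shrinking interval all of whose orbit
measures, and all of whose invariant measures, are close to the given one. -/
theorem exists_isPeriodicShrinking_measureDist_lt (hf : IsTypical f) (Ψ : ℕ → C(I, I)) {c : I}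
    {μ : ProbabilityMeasure I} (h : IsClosable f (c, μ)) {ε : ℝ} (hε : 0 < ε) :
    ∃ (a b : I) (p : ℕ+), IsPeriodicShrinking f a b p ∧ ∀ ν ∈ invariantMeasures f,
      (ν : Measure I) (orbitSet f a b p) = 1 → measureDist Ψ ν μ < ε := by
  obtain ⟨q, hq1, hdist⟩ := exists_forall_isPeriodicShrinking_measureDist_lt Ψ (half_pos hε)
  have hopen : IsOpen {ν | measureDist Ψ ν μ < ε / 2} :=
    isOpen_lt (continuous_measureDist Ψ μ) continuous_const
  obtain ⟨a, b, p, hs, hlen, hW⟩ := hf.mem_shrinkingIn _ h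
    (Prod.snd ⁻¹' {ν | measureDist Ψ ν μ < ε / 2})
    ((hopen.preimage continuous_snd).mem_nhds (by
      change measureDist Ψ μ μ < ε / 2
      rw [measureDist_self]
      exact half_pos hε)) q hq1
  refine ⟨a, b, p, hs, fun ν hν hone => ?_⟩
  have ha := left_mem_Icc.2 hs.lt.le
  have h1 := hdist f a b p hs hlen a ha ν hν hone
  have h2 : measureDist Ψ (orbitMeasure f a p) μ < ε / 2 := hW a ha
  linarith [measureDist_triangle Ψ ν (orbitMeasure f a p) μ]

theorem exists_Icc_subset_Icc (hf : IsTypical f) {a b : I} {p : ℕ+}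
    (h : IsPeriodicShrinking f a b p) {q : ℕ} (hq : 1 ≤ q) :
    ∃ (a' b' : I) (p' : ℕ+), IsPeriodicShrinking f a' b' p' ∧ Icc a' b' ⊆ Icc a b ∧
      (b' : ℝ) - a' < 1 / q := by
  obtain ⟨z, hz, hfix, -⟩ := h.exists_mem_periodicMeasures
  -- Only the point coordinate is used: it locates the new interval inside `(a, b)`, with no
  -- relation needed between the two periods.
  obtain ⟨a', b', p', hs, hlen, hW⟩ := hf.mem_shrinkingIn _ (isClosable_of_iterate_eq hfix)
    (Prod.fst ⁻¹' Ioo a b) ((isOpen_Ioo.preimage continuous_fst).mem_nhds hz) q hq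
  exact ⟨a', b', p', hs, fun x hx => Ioo_subset_Icc_self (hW x hx), hlen⟩

/-- The orbit of every periodic shrinking interval carries an infinitely shrinked measure. -/
theorem exists_mem_shrinkedMeasures (hf : IsTypical f) {a b : I} {p : ℕ+}
    (h : IsPeriodicShrinking f a b p) :
    ∃ ν ∈ shrinkedMeasures f, (ν : Measure I) (orbitSet f a b p) = 1 := by
  let S := {w : I × I × ℕ+ // IsPeriodicShrinking f w.1 w.2.1 w.2.2}
  have hstep : ∀ (k : ℕ) (w : S), ∃ w' : S, Icc w'.1.1 w'.1.2.1 ⊆ Icc w.1.1 w.1.2.1 ∧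
      (w'.1.2.1 : ℝ) - w'.1.1 < 1 / (k + 1 : ℕ) := by
    intro k w
    obtain ⟨a', b', p', hs, hsub, hlen⟩ := hf.exists_Icc_subset_Icc w.2 (show 1 ≤ k + 1 by omega)
    exact ⟨⟨(a', b', p'), hs⟩, hsub, hlen⟩
  choose next hsub hlen using hstep
  let s : ℕ → S := fun k => Nat.rec ⟨(a, b, p), h⟩ (fun k w => next k w) k
  let K : ℕ → Set I := fun k => orbitSet f (s k).1.1 (s k).1.2.1 (s k).1.2.2
  let M : ℕ → Set (ProbabilityMeasure I) := fun k =>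
    invariantMeasures f ∩ {ν | (ν : Measure I) (K k) = 1}
  have hMclosed : ∀ k, IsClosed (M k) := fun k =>
    (isClosed_invariantMeasures f).inter (isClosed_setOf_apply_eq_one (isClosed_orbitSet _ _ _ _))
  have hMmono : ∀ k, M (k + 1) ⊆ M k := by
    rintro k ν ⟨hν, hν1⟩
    refine ⟨hν, le_antisymm prob_le_one ?_⟩
    replace hν1 : (ν : Measure I) (K (k + 1)) = 1 := hν1
    rw [← hν1]
    exact measure_mono ((s k).2.orbitSet_subset (hsub k (s k)) _)
  have hMne : ∀ k, (M k).Nonempty := fun k => by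
    obtain ⟨z, -, -, hper, hone⟩ := (s k).2.exists_mem_periodicMeasures
    exact ⟨_, periodicMeasures_subset_invariantMeasures f hper, hone⟩
  -- The orbit sets of the nested intervals decrease, so by compactness some invariant measure is
  -- carried by all of them.
  obtain ⟨ν, hν⟩ := IsCompact.nonempty_iInter_of_sequence_nonempty_isCompact_isClosed M hMmono hMne
    (hMclosed 0).isCompact hMclosed
  rw [mem_iInter] at hν
  refine ⟨ν, ⟨(hν 0).1, fun q hq => ?_⟩, (hν 0).2⟩
  obtain ⟨q, rfl⟩ := Nat.exists_eq_add_of_le' hq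
  exact ⟨_, _, _, (s (q + 1)).2, hlen q (s q), (hν (q + 1)).2⟩

theorem mem_closure_shrinkedMeasures (hf : IsTypical f) {Ψ : ℕ → C(I, I)} (hΨ : DenseRange Ψ)
    {c : I} {μ : ProbabilityMeasure I} (h : IsClosable f (c, μ)) :
    μ ∈ closure (shrinkedMeasures f) := by
  refine mem_closure_of_measureDist hΨ fun ε hε => ?_
  obtain ⟨a, b, p, hs, hdist⟩ := hf.exists_isPeriodicShrinking_measureDist_lt Ψ h hε
  obtain ⟨ν, hν, hone⟩ := hf.exists_mem_shrinkedMeasures hs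
  exact ⟨ν, hν, (measureDist_comm Ψ _ _).trans_lt (hdist ν hν.1 hone)⟩

/-- Every point of a suitable shrinking interval has all its limit measures carried by the orbit of
that interval, hence close to `μ`; the interval has positive length. -/
theorem mem_pseudoPhysical (hf : IsTypical f) (Ψ : ℕ → C(I, I)) {c : I}
    {μ : ProbabilityMeasure I} (h : IsClosable f (c, μ)) : μ ∈ pseudoPhysical Ψ f := by
  intro ε hε
  obtain ⟨a, b, p, hs, hdist⟩ := hf.exists_isPeriodicShrinking_measureDist_lt Ψ h hε
  have hsub : Ioo a b ⊆ basin Ψ f ε μ := by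
    intro x hx
    obtain ⟨ν, hν⟩ := pomega_nonempty f x
    exact ⟨ν, hν, hdist ν (pomega_subset_invariantMeasures f x hν)
      (hs.pomega_orbitSet (n := 0) (Ioo_subset_Icc_self hx) hν)⟩
  refine lt_of_lt_of_le ?_ (measure_mono hsub)
  rw [unitInterval.volume_Ioo, ENNReal.ofReal_pos]
  exact sub_pos.2 hs.lt

/-- A basin of positive measure contains a point captured at every scale `q`, and every limit
measure of such a point is infinitely shrinked. -/
theorem pseudoPhysical_subset (hf : IsTypical f) {Ψ : ℕ → C(I, I)} (hΨ : DenseRange Ψ) :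
    pseudoPhysical Ψ f ⊆ closure (shrinkedMeasures f) := by
  intro μ hμ
  refine mem_closure_of_measureDist hΨ fun ε hε => ?_
  obtain ⟨x, ⟨ν, hν, hνμ⟩, hx⟩ : ∃ x ∈ basin Ψ f ε μ, ∀ q : ℕ, 1 ≤ q → x ∈ capturedSet f q := by
    by_contra! hcon
    refine (hμ ε hε).ne' (measure_mono_null (fun x hx => ?_) hf.ae_mem_capturedSet)
    obtain ⟨q, hq, hxq⟩ := hcon x hx
    exact fun hall => hxq (hall q hq)
  refine ⟨ν, ⟨pomega_subset_invariantMeasures f x hν, fun q hq => ?_⟩,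
    (measureDist_comm Ψ _ _).trans_lt hνμ⟩
  obtain ⟨n, a, b, p, hs, hlen, hn⟩ := hx q hq
  exact ⟨a, b, p, hs, hlen, hs.pomega_orbitSet (Ioo_subset_Icc_self hn) hν⟩

end IsTypical

end IntervalDynamics

open IntervalDynamics
theorem mainTheorem1 (Ψ : ℕ → C(I, I)) (hΨ : DenseRange Ψ) :
    ∃ G : Set C(I, I), IsGδ G ∧ Dense G ∧ ∀ f ∈ G,
      (∀ ε : ℝ, 0 < ε →
        periodicMeasures f ⊆ ⋂ (q : ℕ) (_ : 1 ≤ q), closure (approxShrinkedPeriodic Ψ f ε q)) ∧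
      (⋂ (ε : ℝ) (_ : 0 < ε) (q : ℕ) (_ : 1 ≤ q), closure (approxShrinkedPeriodic Ψ f ε q)) =
        pseudoPhysical Ψ f ∧
      pseudoPhysical Ψ f = closure (shrinkedMeasures f) ∧
      closure (shrinkedMeasures f) = closure (ergodicMeasures f) ∧
      closure (ergodicMeasures f) = closure (periodicMeasures f) ∧
      (∀ μ : ProbabilityMeasure I, Ergodic f (μ : Measure I) → μ ∈ pseudoPhysical Ψ f) := by
  obtain ⟨G, hGδ, hGd, hG⟩ := exists_isGδ_dense_isTypical
  refine ⟨G, hGδ, hGd, fun f hfG => ?_⟩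
  have hf := hG f hfG
  have hPer : ∀ ε : ℝ, 0 < ε → periodicMeasures f ⊆
      ⋂ (q : ℕ) (_ : 1 ≤ q), closure (approxShrinkedPeriodic Ψ f ε q) := by
    intro ε hε μ hμ
    obtain ⟨c, hc⟩ := exists_isClosable_of_mem_periodicMeasures hμ
    exact mem_iInter₂.2 fun q hq => closure_mono
      (shrinkedPeriodic_subset_approxShrinkedPeriodic Ψ f hε q)
      (hf.mem_closure_shrinkedPeriodic hc hq)
  have hPerE : closure (periodicMeasures f) ⊆ closure (ergodicMeasures f) :=
    closure_mono (periodicMeasures_subset_ergodicMeasures f)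
  have hEPer : ergodicMeasures f ⊆ closure (periodicMeasures f) := fun μ hμ => by
    obtain ⟨c, hc⟩ := exists_isClosable_of_ergodic hΨ hμ
    exact closure_mono (fun _ h => h.1) (hf.mem_closure_shrinkedPeriodic hc le_rfl)
  have hEShr : ergodicMeasures f ⊆ closure (shrinkedMeasures f) := fun μ hμ => by
    obtain ⟨c, hc⟩ := exists_isClosable_of_ergodic hΨ hμ
    exact hf.mem_closure_shrinkedMeasures hΨ hc
  have hEO : ergodicMeasures f ⊆ pseudoPhysical Ψ f := fun μ hμ => by
    obtain ⟨c, hc⟩ := exists_isClosable_of_ergodic hΨ hμ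
    exact hf.mem_pseudoPhysical Ψ hc
  have hShrPer := shrinkedMeasures_subset_closure_periodicMeasures hΨ f
  have hEP : closure (ergodicMeasures f) = closure (periodicMeasures f) :=
    (closure_minimal hEPer isClosed_closure).antisymm hPerE
  have hShrE : closure (shrinkedMeasures f) = closure (ergodicMeasures f) :=
    (closure_minimal (hShrPer.trans hPerE) isClosed_closure).antisymm
      (closure_minimal hEShr isClosed_closure)
  have hO : pseudoPhysical Ψ f = closure (shrinkedMeasures f) := by
    refine (hf.pseudoPhysical_subset hΨ).antisymm ?_
    rw [hShrE]
    exact closure_minimal hEO (isClosed_pseudoPhysical Ψ f)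
  refine ⟨hPer, ?_, hO, hShrE, hEP, hEO⟩
  rw [hO, hShrE, hEP]
  refine Subset.antisymm (fun μ hμ => ?_) ?_
  · refine mem_closure_of_measureDist hΨ fun ε hε => ?_
    simp only [mem_iInter] at hμ
    -- The scale `q = 1` suffices, since only the periodicity of the approximating measure `ρ` is
    -- needed.
    obtain ⟨ν, ⟨-, ρ, hρ, hνρ⟩, hνμ⟩ := exists_measureDist_lt_of_mem_closure Ψ
      (hμ (ε / 2) (half_pos hε) 1 le_rfl) (half_pos hε)
    refine ⟨ρ, hρ.1, ?_⟩
    rw [measureDist_comm] at hνμ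
    linarith [measureDist_triangle Ψ μ ν ρ]
  · refine closure_minimal (fun μ hμ => mem_iInter₂.2 fun ε hε => hPer ε hε hμ) ?_
    exact isClosed_iInter fun _ => isClosed_iInter fun _ => isClosed_iInter fun _ =>
      isClosed_iInter fun _ => isClosed_closure
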